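/- Let $n\ge 0$, $\mu\ge 1$, $N\ge 0$ be integers, $a(0),\dots,a(N)\in\mathbb C$, and let $\{\xi(m):m\in\mathbb Z\}$ be a sequence of complex random variables whose $n$th increments $$\xi^{(n)}(m,s)=\sum_{l=0}^n(-1)^l\binom nl\,\xi(m-ls),\qquad m,s\in\mathbb Z,$$ are square integrable and wide sense stationary: $E\,\xi^{(n)}(m_0,s)$ and $E\,\xi^{(n)}(m_0+m,s_1)\overline{\xi^{(n)}(m_0,s_2)}$ do not depend on $m_0$. Assume that the spectral function $F$ is absolutely continuous with density $f$, normalized by $dF(\lambda)=\frac1{2\pi}f(\lambda)\,d\lambda$ on $[-\pi,\pi)$, that is, $$E\,\xi^{(n)}(m_0+m,s_1)\overline{\xi^{(n)}(m_0,s_2)}=\int_{-\pi}^{\pi}e^{i\lambda m}(1-e^{-is_1\lambda})^n(1-e^{is_2\lambda})^n\lambda^{-2n}\,dF(\lambda),$$ and that $f(\lambda)=|\Phi(e^{-i\lambda})|^2$, where $\Phi$ is a power series with radius of convergence greater than $1$ and without zeros in $\{|z|\le1\}$. Assume also that the increments with step $\mu$ have a canonical moving average representation $$\xi^{(n)}(m,\mu)=\sum_{k\ge0}\varphi_\mu(k)\,\varepsilon(m-k)\quad(m\in\mathbb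 Z),\qquad \sum_k|\varphi_\mu(k)|^2<\infty,$$ where $\varepsilon$ is an innovation sequence: the $\varepsilon(m)$ are centred, uncorrelated, of variance $1$, and for every $t$ the closed linear span of $\{\varepsilon(m):m\le t\}$ in $L_2(P)$ is that of $\{\xi^{(n)}(m,s):m\le t,\ s>0\}$. Put $\Phi_\mu(e^{-i\lambda})=\sum_k\varphi_\mu(k)e^{-i\lambda k}$ (convergence in $L_2[-\pi,\pi)$). A linear estimate of $A_N\xi=\sum_{k=0}^Na(k)\xi(k)$ from the observations $\xi(m)$, $m\le-1$, is a mean square limit of finite sums $\sum_{k\le-1}c_k\xi(k)$ for which the error functional $\sum_{k=0}^Na(k)x(k)-\sum_{k\le-1}c_kx(k)$ of a sequence $x$ is a finite linear combination of $n$th increments of $x$. Let $d_\mu(k)$ be defined by $\sum_{k\ge0}d_\mu(k)x^k=\bigl(\sum_{j\ge0}x^{\mu j}\bigr)^n$, put $b_{\mu,N}(k)=\sum_{m=k}^Na(m)d_\mu(m-k)$ for $0\le k\le N$, and $$v_{\mu,N}(k)=\sum_{l=\lceil -k/\mu\rceil}^{\min\{\lfloor (N-k)/\mu\rfloor,\,n\}}(-1)^l\binom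 nl\, b_{\mu,N}(l\mu+k),\qquad k=-1,\dots,-\mu n.$$ Let $D_N^\mu$ and $A_N$ be the $(N+1)\times(N+1)$ matrices with entries $(D_N^\mu)_{k,j}=d_\mu(j-k)$ for $k\le j$ and $0$ for $j<k$; $(A_N)_{k,j}=a(k+j)$ for $k+j\le N$ and $0$ for $k+j>N$ ($0\le k,j\le N$). Put $a_N=(a(0),\dots,a(N))$, $\varphi_{\mu,N}=(\varphi_\mu(0),\dots,\varphi_\mu(N))$. Then there is an orthogonal stochastic measure $Z$ on $[-\pi,\pi)$ with $E\,Z(S_1)\overline{Z(S_2)}=F(S_1\cap S_2)$ and $\xi^{(n)}(m,s)=\int_{-\pi}^\pi e^{i\lambda m}(1-e^{-is\lambda})^n(i\lambda)^{-n}\,dZ(\lambda)$ for all $m,s\in\mathbb Z$; a mean square optimal linear estimate $\hat A_N\xi$ of $A_N\xi$ exists; and for every such $Z$ and $\hat A_N\xi$, almost surely, $$\hat A_N\xi=-\sum_{k=-\mu n}^{-1}v_{\mu,N}(k)\,\xi(k)+\int_{-\pi}^{\pi}h_{\mu,N}(\lambda)\,(1-e^{-i\lambda\mu})^n\frac1{(i\lambda)^n}\,dZ(\lambda),$$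 where the spectral characteristic $h_{\mu,N}$ is determined uniquely almost everywhere by this equation and is $$h_{\mu,N}(\lambda)=\sum_{k=0}^N(D_N^\mu a_N)_k\,e^{i\lambda k}-r_{\mu,N}(e^{i\lambda})\,\Phi_\mu(e^{-i\lambda})^{-1},\qquad r_{\mu,N}(e^{i\lambda})=\sum_{j=0}^N(D_N^\mu A_N\varphi_{\mu,N})_j\,e^{i\lambda j}.$$ The mean square error is $$E|A_N\xi-\hat A_N\xi|^2=\frac1{2\pi}\int_{-\pi}^{\pi}|r_{\mu,N}(e^{i\lambda})|^2\,d\lambda=\|D_N^\mu A_N\varphi_{\mu,N}\|^2.$$ Moreover, if the $\xi(k)$, $k\le-1$, are square integrable and uncorrelated with the $\varepsilon(j)$, $j\ge0$ (that is, $E\,\xi(k)\overline{\varepsilon(j)}=0$), then the optimal linear estimates just described are exactly the mean square optimal ones among all mean square limits of finite linear combinations of the $\xi(k)$, $k\le-1$. -/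

import Mathlib

open MeasureTheory Filter Topology
open scoped ENNReal

namespace StationaryIncrements

noncomputable section

/-! ### Increments, stationarity, spectral density -/

/-- The `n`th increment `x⁽ⁿ⁾(m, s) = ∑_{l ≤ n} (-1)^l C(n, l) x(m - l s)` with step `s`. -/
def nthIncr (n : ℕ) (x : ℤ → ℂ) (m s : ℤ) : ℂ :=
  ∑ l ∈ Finset.range (n + 1), (-1 : ℂ) ^ l * (n.choose l : ℂ) * x (m - l * s)

/-- The `n`th increment of a stochastic sequence, as a random variable. -/
def incr {Ω : Type*} (n : ℕ) (ξ : ℤ → Ω → ℂ) (m s : ℤ) : Ω → ℂ :=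
  fun ω => nthIncr n (fun k => ξ k ω) m s

/-- Wide sense stationarity of the `n`th increments: first and second moments exist and depend
only on the steps and on the time difference. -/
structure HasStationaryIncrements {Ω : Type*} [MeasurableSpace Ω] (P : Measure Ω) (n : ℕ)
    (ξ : ℤ → Ω → ℂ) : Prop where
  memLp : ∀ m s : ℤ, MemLp (incr n ξ m s) 2 P
  mean : ∃ c : ℤ → ℂ, ∀ m s : ℤ, ∫ ω, incr n ξ m s ω ∂P = c s
  structural : ∃ D : ℤ → ℤ → ℤ → ℂ, ∀ m₀ m s₁ s₂ : ℤ,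
    ∫ ω, incr n ξ (m₀ + m) s₁ ω * starRingEnd ℂ (incr n ξ m₀ s₂ ω) ∂P = D m s₁ s₂

/-- Lebesgue measure on `[-π, π)`. -/
def circleVolume : Measure ℝ := volume.restrict (Set.Ico (-Real.pi) Real.pi)

/-- The measure `dF = f(t) dt / (2π)` on `[-π, π)` given by a spectral density `f`. -/
def spectralMeasure (f : ℝ → ℝ) : Measure ℝ :=
  circleVolume.withDensity fun t => ENNReal.ofReal (f t / (2 * Real.pi))

/-- `(1 - e^{-i s t})^n / (i t)^n`. -/
def transfer (n : ℕ) (s : ℤ) (t : ℝ) : ℂ :=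
  (1 - Complex.exp (-(Complex.I * s * t))) ^ n / (Complex.I * t) ^ n

/-- `f` is the spectral density of the stationary `n`th increments of `ξ`: the spectral function
`F` is absolutely continuous with `dF = f dt / (2π)`, and the structural function is
`∫ e^{itm} (1 - e^{-i s₁ t})^n (1 - e^{i s₂ t})^n t^{-2n} dF(t)`. -/
structure IsSpectralDensity {Ω : Type*} [MeasurableSpace Ω] (P : Measure Ω) (n : ℕ)
    (ξ : ℤ → Ω → ℂ) (f : ℝ → ℝ) : Prop where
  nonneg : ∀ᵐ t ∂circleVolume, 0 ≤ f t
  integrable : Integrable f circleVolume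
  structural : ∀ m₀ m s₁ s₂ : ℤ,
    ∫ ω, incr n ξ (m₀ + m) s₁ ω * starRingEnd ℂ (incr n ξ m₀ s₂ ω) ∂P =
      ∫ t, Complex.exp (Complex.I * t * m) * (1 - Complex.exp (-(Complex.I * s₁ * t))) ^ n *
        (1 - Complex.exp (Complex.I * s₂ * t)) ^ n * (1 / (t : ℂ) ^ (2 * n)) ∂(spectralMeasure f)

/-- The canonical factorization `f(t) = |Φ(e^{-it})|²`, where `Φ(z) = ∑ φ(k) z^k` has radius of
convergence greater than `1` and no zeros in the closed unit disk. -/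
def HasCanonicalFactorization (f : ℝ → ℝ) : Prop :=
  ∃ φ : ℕ → ℂ, (∃ r : ℝ, 1 < r ∧ Summable fun k => ‖φ k‖ * r ^ k) ∧
    (∀ z : ℂ, ‖z‖ ≤ 1 → ∑' k, φ k * z ^ k ≠ 0) ∧
    ∀ᵐ t ∂circleVolume, f t = ‖∑' k, φ k * Complex.exp (-(Complex.I * t)) ^ k‖ ^ 2

/-! ### The canonical moving average representation -/

/-- The closed linear subspace of `L²(P)` generated by the random variables `X i`, `i ∈ S`. -/
def closedSpan {Ω ι : Type*} [MeasurableSpace Ω] (P : Measure Ω) (X : ι → Ω → ℂ) (S : Set ι) :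
    Submodule ℂ (Lp ℂ 2 P) :=
  (Submodule.span ℂ {Y : Lp ℂ 2 P | ∃ i ∈ S, Y =ᵐ[P] X i}).topologicalClosure

/-- `ε` is an innovation sequence for the `n`th increments of `ξ`: centred, uncorrelated, of
variance `1`, and for every `t` the increments `ξ⁽ⁿ⁾(m, s)`, `m ≤ t`, `s > 0`, generate the same
closed subspace as the `ε m`, `m ≤ t`. -/
structure IsInnovation {Ω : Type*} [MeasurableSpace Ω] (P : Measure Ω) (n : ℕ)
    (ξ ε : ℤ → Ω → ℂ) : Prop where
  memLp : ∀ m, MemLp (ε m) 2 P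
  mean : ∀ m, ∫ ω, ε m ω ∂P = 0
  cov : ∀ m k, ∫ ω, ε m ω * starRingEnd ℂ (ε k ω) ∂P = if m = k then 1 else 0
  past : ∀ t : ℤ,
    closedSpan P (fun p : ℤ × ℤ => incr n ξ p.1 p.2) {p | p.1 ≤ t ∧ 0 < p.2} =
      closedSpan P ε {m | m ≤ t}

/-- `ξ⁽ⁿ⁾(m, μ) = ∑_{k ≥ 0} φ(k) ε(m - k)` in mean square, with square summable coefficients and an
innovation sequence `ε`. -/
structure IsCanonicalMovingAverage {Ω : Type*} [MeasurableSpace Ω] (P : Measure Ω) (n μ : ℕ)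
    (ξ ε : ℤ → Ω → ℂ) (φ : ℕ → ℂ) : Prop where
  innovation : IsInnovation P n ξ ε
  summable : Summable fun k => ‖φ k‖ ^ 2
  hasSum : ∀ m : ℤ, Tendsto
    (fun K : ℕ => eLpNorm
      (fun ω => incr n ξ m μ ω - ∑ k ∈ Finset.range K, φ k * ε (m - k) ω) 2 P) atTop (𝓝 0)

/-! ### Orthogonal stochastic measures -/

/-- The integral `∑ c Z(s = c)` of a simple function. -/
def simpleStochIntegral {Ω : Type*} [MeasurableSpace Ω] {P : Measure Ω} (Z : Set ℝ → Lp ℂ 2 P)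
    (s : SimpleFunc ℝ ℂ) : Lp ℂ 2 P :=
  ∑ c ∈ s.range, c • Z (s ⁻¹' {c})

/-- `X = ∫ g dZ`: the mean square limit of integrals of simple functions that converge to `g`
in `L²(F)`. -/
def HasStochIntegral {Ω : Type*} [MeasurableSpace Ω] {P : Measure Ω} (F : Measure ℝ)
    (Z : Set ℝ → Lp ℂ 2 P) (g : ℝ → ℂ) (X : Ω → ℂ) : Prop :=
  MemLp g 2 F ∧ MemLp X 2 P ∧ ∃ s : ℕ → SimpleFunc ℝ ℂ,
    Tendsto (fun j => eLpNorm (fun t => g t - s j t) 2 F) atTop (𝓝 0) ∧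
    Tendsto (fun j => eLpNorm (fun ω => X ω - simpleStochIntegral Z (s j) ω) 2 P) atTop (𝓝 0)

/-- `Z` is an orthogonal stochastic measure, `E Z(A) conj Z(B) = F(A ∩ B)`, which represents the
increments: `ξ⁽ⁿ⁾(m, s) = ∫ e^{itm} (1 - e^{-ist})^n (it)^{-n} dZ(t)`. -/
structure IsSpectralRepresentation {Ω : Type*} [MeasurableSpace Ω] {P : Measure Ω} (n : ℕ)
    (ξ : ℤ → Ω → ℂ) (F : Measure ℝ) (Z : Set ℝ → Lp ℂ 2 P) : Prop where
  orthogonal : ∀ A B : Set ℝ, MeasurableSet A → MeasurableSet B →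
    ∫ ω, Z A ω * starRingEnd ℂ (Z B ω) ∂P = ((F (A ∩ B)).toReal : ℂ)
  represents : ∀ m s : ℤ,
    HasStochIntegral F Z (fun t => Complex.exp (Complex.I * t * m) * transfer n s t) (incr n ξ m s)

/-! ### Linear estimates -/

/-- The functional `∑_{k = 0}^N a(k) ξ(k)`. -/
def functionalAN {Ω : Type*} (N : ℕ) (a : ℕ → ℂ) (ξ : ℤ → Ω → ℂ) : Ω → ℂ :=
  fun ω => ∑ k ∈ Finset.range (N + 1), a k * ξ k ω

/-- Coefficient systems of finite linear combinations of the values at times `k ≤ -1`. -/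
def observedCoeffs : Set (ℤ →₀ ℂ) := {c | ∀ k ∈ c.support, k ≤ -1}

/-- The observed coefficient systems `c` for which the error functional
`x ↦ ∑_{k ≤ N} a(k) x(k) - ∑ c(k) x(k)` is a finite linear combination of `n`th increments
of the sequence `x`. -/
def incrementErrorCoeffs (n N : ℕ) (a : ℕ → ℂ) : Set (ℤ →₀ ℂ) :=
  {c | c ∈ observedCoeffs ∧ ∃ g : ℤ × ℤ →₀ ℂ, ∀ x : ℤ → ℂ,
    (∑ k ∈ Finset.range (N + 1), a k * x k) - (c.sum fun k z => z * x k) =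
      g.sum fun p z => z * nthIncr n x p.1 p.2}

/-- The linear estimates with coefficients in `S`: mean square limits of combinations
`∑ c(k) ξ(k)`, `c ∈ S`. -/
def linearEstimates {Ω : Type*} [MeasurableSpace Ω] (P : Measure Ω) (ξ : ℤ → Ω → ℂ)
    (S : Set (ℤ →₀ ℂ)) : Set (Ω → ℂ) :=
  {η | AEMeasurable η P ∧ ∀ δ : ℝ≥0∞, 0 < δ →
    ∃ c ∈ S, eLpNorm (fun ω => η ω - c.sum fun k z => z * ξ k ω) 2 P < δ}

/-- The mean square error `E|A - η|²`, as an extended nonnegative number. -/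
def mse {Ω : Type*} [MeasurableSpace Ω] (P : Measure Ω) (A η : Ω → ℂ) : ℝ≥0∞ :=
  ∫⁻ ω, ‖A ω - η ω‖ₑ ^ 2 ∂P

/-- `η` is a mean square optimal estimate of `A` among the linear estimates with coefficients
in `S`. -/
def IsOptimalEstimate {Ω : Type*} [MeasurableSpace Ω] (P : Measure Ω) (ξ : ℤ → Ω → ℂ)
    (S : Set (ℤ →₀ ℂ)) (A η : Ω → ℂ) : Prop :=
  η ∈ linearEstimates P ξ S ∧ ∀ η' ∈ linearEstimates P ξ S, mse P A η ≤ mse P A η'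

/-! ### The quantities in the formulas -/

/-- `d_μ(k)`, the coefficient of `x^k` in `(∑_j x^{μ j})^n`. -/
def dCoeff (n μ k : ℕ) : ℂ :=
  PowerSeries.coeff k ((PowerSeries.mk fun j => if μ ∣ j then (1 : ℂ) else 0) ^ n)

/-- `b_{μ,N}(k) = ∑_{m = k}^N a(m) d_μ(m - k)`. -/
def bCoeff (n μ N : ℕ) (a : ℕ → ℂ) (k : ℕ) : ℂ :=
  ∑ m ∈ Finset.Icc k N, a m * dCoeff n μ (m - k)

/-- `v_{μ,N}(k) = ∑ (-1)^l C(n, l) b_{μ,N}(l μ + k)` over `⌈-k/μ⌉ ≤ l ≤ min(⌊(N-k)/μ⌋, n)`,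
for `-μ n ≤ k ≤ -1`. -/
def vCoeff (n μ N : ℕ) (a : ℕ → ℂ) (k : ℤ) : ℂ :=
  ∑ l ∈ Finset.Icc ⌈-(k : ℚ) / μ⌉₊ (min ⌊((N : ℚ) - k) / μ⌋₊ n),
    (-1 : ℂ) ^ l * (n.choose l : ℂ) * bCoeff n μ N a ((l : ℤ) * μ + k).toNat

/-- The matrix `D_N^μ`. -/
def matD (n μ N : ℕ) : Matrix (Fin (N + 1)) (Fin (N + 1)) ℂ :=
  Matrix.of fun k j => if k ≤ j then dCoeff n μ ((j : ℕ) - (k : ℕ)) else 0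

/-- The matrix `A_N`. -/
def matA (N : ℕ) (a : ℕ → ℂ) : Matrix (Fin (N + 1)) (Fin (N + 1)) ℂ :=
  Matrix.of fun k j => if (k : ℕ) + (j : ℕ) ≤ N then a ((k : ℕ) + (j : ℕ)) else 0

/-- The vector of the first `N + 1` terms of a sequence. -/
def vecN (N : ℕ) (u : ℕ → ℂ) : Fin (N + 1) → ℂ := fun k => u k

/-- The trigonometric polynomial `∑_{k ≤ N} u_k e^{itk}`. -/
def trigPoly {N : ℕ} (u : Fin (N + 1) → ℂ) (t : ℝ) : ℂ :=
  ∑ k, u k * Complex.exp (Complex.I * t * (k : ℕ))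

/-- `e^{-itk}` as an element of `L²[-π, π)`. -/
def expL2 (k : ℕ) : Lp ℂ 2 circleVolume :=
  MemLp.toLp (fun t : ℝ => Complex.exp (-(Complex.I * t * k))) <| by
    have : IsFiniteMeasure circleVolume := by
      unfold circleVolume
      infer_instance
    refine MemLp.of_bound (Continuous.aestronglyMeasurable (by fun_prop)) 1 ?_
    refine Eventually.of_forall fun t => le_of_eq ?_
    rw [Complex.norm_exp]
    simp

/-- The boundary function `Φ(e^{-it}) = ∑_k φ(k) e^{-itk}` of a square summable sequence `φ`, the
series being summed in `L²[-π, π)`. -/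
def boundary (φ : ℕ → ℂ) : Lp ℂ 2 circleVolume := ∑' k, φ k • expL2 k

/-- `A_N(e^{it}) = ∑ (D_N^μ a_N)_k e^{itk}`. -/
def symbolA (n μ N : ℕ) (a : ℕ → ℂ) (t : ℝ) : ℂ :=
  trigPoly ((matD n μ N).mulVec (vecN N a)) t

/-- The vector `D_N^μ A_N φ_{μ,N}`. -/
def errorVec (n μ N : ℕ) (a φ : ℕ → ℂ) : Fin (N + 1) → ℂ :=
  (matD n μ N * matA N a).mulVec (vecN N φ)

/-- `r_{μ,N}(e^{it}) = ∑ (D_N^μ A_N φ_{μ,N})_j e^{itj}`. -/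
def symbolR (n μ N : ℕ) (a φ : ℕ → ℂ) (t : ℝ) : ℂ := trigPoly (errorVec n μ N a φ) t

/-- `h_{μ,N}(t) = A_N(e^{it}) - r_{μ,N}(e^{it}) Φ_μ(e^{-it})⁻¹`. -/
def specChar (n μ N : ℕ) (a φ : ℕ → ℂ) (t : ℝ) : ℂ :=
  symbolA n μ N a t - symbolR n μ N a φ t * (boundary φ t)⁻¹

/-- `η = -∑_{k = -μn}^{-1} v_{μ,N}(k) ξ(k) + ∫ h(t) (1 - e^{-itμ})^n (it)^{-n} dZ(t)`:
`h` is a spectral characteristic of the estimate `η`. -/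
def IsSpectralCharacteristic {Ω : Type*} [MeasurableSpace Ω] {P : Measure Ω} (n μ N : ℕ)
    (a : ℕ → ℂ) (ξ : ℤ → Ω → ℂ) (F : Measure ℝ) (Z : Set ℝ → Lp ℂ 2 P) (h : ℝ → ℂ)
    (η : Ω → ℂ) : Prop :=
  ∃ X : Ω → ℂ, HasStochIntegral F Z (fun t => h t * transfer n μ t) X ∧
    η =ᵐ[P] fun ω =>
      -(∑ k ∈ Finset.Icc (-((μ : ℤ) * n)) (-1), vCoeff n μ N a k * ξ k ω) + X ω

end

end StationaryIncrements

open StationaryIncrements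

namespace StationaryIncrements

noncomputable section

/-! ### Hilbert space preliminaries -/

section Hilbert

open scoped InnerProductSpace

variable {E G : Type*} [NormedAddCommGroup E] [InnerProductSpace ℂ E]
  [NormedAddCommGroup G] [InnerProductSpace ℂ G]

/-! The formula for the structural function says that the kernels `e^{itm} (1 - e^{-ist})^n
(it)^{-n}` in `L²(F)` and the increments in `L²(P)` have the same Gram matrix. Hence an isometry `J
: L²(F) → L²(P)` maps kernels to increments (`exists_spectralIsometry`). The kernels are total,
since for a nonzero step the transfer function is almost nowhere zero; so integration against any
admissible `Z` is `J` itself (`hasStochIntegral_iff`, `isometry_indL2_of_representation`), and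
computations can be done in `L²(F)`.

There the time shift is multiplication by `e^{itj}`. It moves pasts to pasts, so it takes the
innovation `g` at time `0` to a multiple of the one at time `j`; the multiple is `1` because the
coefficients `φ` do not depend on time (`spectral_innovation_eq_shift`). Orthonormality of the
`e^{itj} g` gives `f |g|² = 1` almost everywhere, so `f` is almost nowhere zero, and the moving
average gives `g = transfer / Φ_μ` (`exists_innovation_kernel`).

The rest is algebra and projection. Since `(∑ x^{μj})^n` inverts `(1 - x^μ)^n`, the functional is `∑
b(k) ξ⁽ⁿ⁾(k, μ) - ∑ v(k) ξ(k)` (`sum_eq_increments_sub`). The admissible estimates are exactly `-∑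
v(k) ξ(k)` plus the closed span `H` of the past increments (`mem_linearEstimates_increment_iff`), so
`∑ b(k) ξ⁽ⁿ⁾(k, μ)` has to be projected on `H`. As `H` is also the closed span of the `ε(m)`, `m ≤
-1`, the projection error is the part of the moving averages that involves `ε(j)`, `j ≥ 0`; its
coefficients form `D A φ` (`sum_errorVec_smul`). Its norm is the mean square error, and its preimage
under `J` is `r g`, whence the formula for `h`. If the observed values are orthogonal to the later
innovations, the same error is orthogonal to their closed span, which contains `H`, so the
projection does not change. -/

theorem norm_linearCombination_eq_of_inner_eq {ι : Type*} {u : ι → E} {w : ι → G}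
    (h : ∀ i j, ⟪u i, u j⟫_ℂ = ⟪w i, w j⟫_ℂ) (c : ι →₀ ℂ) :
    ‖Finsupp.linearCombination ℂ u c‖ = ‖Finsupp.linearCombination ℂ w c‖ := by
  have key : ⟪Finsupp.linearCombination ℂ u c, Finsupp.linearCombination ℂ u c⟫_ℂ =
      ⟪Finsupp.linearCombination ℂ w c, Finsupp.linearCombination ℂ w c⟫_ℂ := by
    simp only [Finsupp.linearCombination_apply, Finsupp.sum, sum_inner, inner_sum,
      inner_smul_left, inner_smul_right, h]
  rw [@norm_eq_sqrt_re_inner ℂ, @norm_eq_sqrt_re_inner ℂ, key]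

/-- Two families with the same Gram matrix, the first of which is total, are related by a linear
isometry. -/
theorem exists_linearIsometry_of_inner_eq [CompleteSpace G] {ι : Type*} {u : ι → E} {w : ι → G}
    (h : ∀ i j, ⟪u i, u j⟫_ℂ = ⟪w i, w j⟫_ℂ)
    (hu : (Submodule.span ℂ (Set.range u)).topologicalClosure = ⊤) :
    ∃ J : E →ₗᵢ[ℂ] G, ∀ i, J (u i) = w i := by
  have hdense : DenseRange (Finsupp.linearCombination ℂ u) := by
    have : (Set.range (Finsupp.linearCombination ℂ u)) =
        (Submodule.span ℂ (Set.range u) : Set E) := by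
      rw [← Finsupp.range_linearCombination]; rfl
    rw [DenseRange, this]
    exact Submodule.dense_iff_topologicalClosure_eq_top.2 hu
  have hn := norm_linearCombination_eq_of_inner_eq h
  have hb : ∃ C, ∀ x, ‖Finsupp.linearCombination ℂ w x‖ ≤
      C * ‖Finsupp.linearCombination ℂ u x‖ := ⟨1, fun x => by simp [hn x]⟩
  -- Equality of norms makes `∑ c i • u i ↦ ∑ c i • w i` well defined on a dense subspace;
  -- completeness of `G` extends it.
  let J := (Finsupp.linearCombination ℂ w).extendOfNorm (Finsupp.linearCombination ℂ u)
  have hJ : ∀ x, J (Finsupp.linearCombination ℂ u x) = Finsupp.linearCombination ℂ w x :=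
    LinearMap.extendOfNorm_eq hdense hb
  refine ⟨⟨J.toLinearMap, fun x => ?_⟩, fun i => ?_⟩
  · refine hdense.induction_on (p := fun x => ‖J x‖ = ‖x‖) x
      (isClosed_eq (by fun_prop) (by fun_prop)) fun c => ?_
    rw [hJ, hn]
  · have := hJ (Finsupp.single i 1)
    simpa using this

/-- Linear isometries that agree on a total family are equal. -/
theorem linearIsometry_ext_of_total {ι : Type*} {u : ι → E}
    (hu : (Submodule.span ℂ (Set.range u)).topologicalClosure = ⊤) {J K : E →ₗᵢ[ℂ] G}
    (h : ∀ i, J (u i) = K (u i)) : J = K := by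
  have hd : Dense (Submodule.span ℂ (Set.range u) : Set E) :=
    Submodule.dense_iff_topologicalClosure_eq_top.2 hu
  have : J.toContinuousLinearMap = K.toContinuousLinearMap :=
    ContinuousLinearMap.ext_on hd (by rintro _ ⟨i, rfl⟩; exact h i)
  ext x
  exact DFunLike.congr_fun this x

/-- An isometry is a topological embedding, so closures pull back. This transports equalities of
pasts between `L²(P)` and `L²(F)`. -/
theorem mem_topologicalClosure_span_image_iff (J : E →ₗᵢ[ℂ] G) (A : Set E) (x : E) :
    J x ∈ (Submodule.span ℂ (J '' A)).topologicalClosure ↔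
      x ∈ (Submodule.span ℂ A).topologicalClosure := by
  have h1 : ((Submodule.span ℂ (J '' A) : Submodule ℂ G) : Set G) =
      J '' (Submodule.span ℂ A : Submodule ℂ E) := by
    have := Submodule.map_span J.toLinearMap A
    have h2 := congrArg (fun S : Submodule ℂ G => (S : Set G)) this
    simpa using h2.symm
  rw [← SetLike.mem_coe, ← SetLike.mem_coe, Submodule.topologicalClosure_coe,
    Submodule.topologicalClosure_coe, h1, J.isometry.isEmbedding.closure_eq_preimage_closure_image]
  rfl

theorem inner_eq_zero_of_mem_topologicalClosure_span {A : Set E} {x y : E}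
    (hA : ∀ z ∈ A, ⟪z, y⟫_ℂ = 0) (hx : x ∈ (Submodule.span ℂ A).topologicalClosure) :
    ⟪x, y⟫_ℂ = 0 := by
  have hle : (Submodule.span ℂ A).topologicalClosure ≤ (Submodule.span ℂ {y})ᗮ := by
    refine Submodule.topologicalClosure_minimal _ (Submodule.span_le.2 fun z hz => ?_)
      (Submodule.isClosed_orthogonal _)
    rw [SetLike.mem_coe, Submodule.mem_orthogonal_singleton_iff_inner_left]
    exact hA z hz
  exact (Submodule.mem_orthogonal_singleton_iff_inner_left).1 (hle hx)

/-- If an isometric shift `U j` moves the generators of the past up to `t` to those of the past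
up to `t + j`, then it moves the innovation at time `0` to a multiple of the one at time `j`. -/
theorem shift_innovation_eq_smul {G' : ℤ → Set E} {g : ℤ → E} (hg : Orthonormal ℂ g)
    (hspan : ∀ t, (Submodule.span ℂ (G' t)).topologicalClosure =
      (Submodule.span ℂ (g '' Set.Iic t)).topologicalClosure)
    (U : E →ₗᵢ[ℂ] E) (j : ℤ) (hU : ∀ t, U '' G' t = G' (t + j)) :
    U (g 0) = ⟪g j, U (g 0)⟫_ℂ • g j := by
  set y := U (g 0) with hy
  have hmem : y ∈ (Submodule.span ℂ (g '' Set.Iic j)).topologicalClosure := by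
    rw [← hspan, show G' j = U '' G' 0 by rw [hU, zero_add], hy,
      mem_topologicalClosure_span_image_iff, hspan]
    exact Submodule.le_topologicalClosure _ (Submodule.subset_span ⟨0, by simp, rfl⟩)
  -- The past up to `j - 1` is the image of the past up to `-1`, which is orthogonal to `g 0`;
  -- isometries keep this.
  have hpast : ∀ m < j, ⟪g m, y⟫_ℂ = 0 := by
    intro m hm
    have h1 : g m ∈ (Submodule.span ℂ (G' (j - 1))).topologicalClosure := by
      rw [hspan]
      exact Submodule.le_topologicalClosure _
        (Submodule.subset_span ⟨m, by simp; omega, rfl⟩)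
    refine inner_eq_zero_of_mem_topologicalClosure_span ?_ h1
    have h2 : G' (j - 1) = U '' G' (-1) := by rw [hU]; congr 1; ring
    rw [h2]
    rintro _ ⟨z, hz, rfl⟩
    rw [hy, LinearIsometry.inner_map_map]
    have hz' : z ∈ (Submodule.span ℂ (g '' Set.Iic (-1))).topologicalClosure := by
      rw [← hspan]
      exact Submodule.le_topologicalClosure _ (Submodule.subset_span hz)
    refine inner_eq_zero_of_mem_topologicalClosure_span ?_ hz'
    rintro _ ⟨k, hk, rfl⟩
    refine hg.2 ?_
    simp at hk
    omega
  -- The remainder lies in the span of the `g k`, `k ≤ j`, and is orthogonal to each of them, hence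
  -- to itself.
  set d := y - ⟪g j, y⟫_ℂ • g j with hd
  have hdmem : d ∈ (Submodule.span ℂ (g '' Set.Iic j)).topologicalClosure :=
    Submodule.sub_mem _ hmem (Submodule.smul_mem _ _
      (Submodule.le_topologicalClosure _ (Submodule.subset_span ⟨j, by simp, rfl⟩)))
  have hd0 : ⟪d, d⟫_ℂ = 0 := by
    refine inner_eq_zero_of_mem_topologicalClosure_span ?_ hdmem
    rintro _ ⟨k, hk, rfl⟩
    rw [hd, inner_sub_right, inner_smul_right]
    rcases lt_or_eq_of_le (show k ≤ j from hk) with h | rfl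
    · rw [hpast k h, hg.2 h.ne]; simp
    · rw [inner_self_eq_norm_sq_to_K, hg.1]; simp
  exact sub_eq_zero.1 (inner_self_eq_zero.1 hd0)

end Hilbert

/-! ### Uniqueness of Fourier coefficients -/

instance : IsFiniteMeasure circleVolume := by
  unfold circleVolume
  infer_instance

/-- The functional `g ↦ ∫ g w` on continuous functions of the circle is bounded and kills the
characters, whose span is dense, so it is zero. Smooth test functions supported in the open interval
are such `g`. Only integrability of `w` is needed, which matters for densities of the form `f |g|²`.
-/
theorem ae_eq_zero_of_fourier_eq_zero {w : ℝ → ℂ} (hw : Integrable w circleVolume)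
    (h : ∀ m : ℤ, ∫ t, Complex.exp (Complex.I * t * m) * w t ∂circleVolume = 0) :
    w =ᵐ[circleVolume] 0 := by
  have : Fact (0 < 2 * Real.pi) := ⟨Real.two_pi_pos⟩
  have hcont : ∀ g : C(AddCircle (2 * Real.pi), ℂ), Continuous fun t : ℝ => g (t : AddCircle _) :=
    fun g => g.continuous.comp (AddCircle.continuous_mk' _)
  have hint : ∀ g : C(AddCircle (2 * Real.pi), ℂ),
      Integrable (fun t : ℝ => g (t : AddCircle _) * w t) circleVolume := fun g =>
    hw.bdd_mul (hcont g).aestronglyMeasurable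
      (Eventually.of_forall fun t => g.norm_coe_le_norm (t : AddCircle _))
  let l : C(AddCircle (2 * Real.pi), ℂ) →ₗ[ℂ] ℂ :=
    { toFun := fun g => ∫ t, g (t : AddCircle _) * w t ∂circleVolume
      map_add' := fun g g' => by
        rw [← integral_add (hint g) (hint g')]
        simp [add_mul]
      map_smul' := fun c g => by
        simp [mul_assoc, integral_const_mul] }
  let L : C(AddCircle (2 * Real.pi), ℂ) →L[ℂ] ℂ :=
    l.mkContinuous (∫ t, ‖w t‖ ∂circleVolume) fun g => by
      rw [← integral_mul_const]
      refine norm_integral_le_of_norm_le (hw.norm.mul_const _) (Eventually.of_forall fun t => ?_)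
      rw [norm_mul, mul_comm]
      gcongr
      exact g.norm_coe_le_norm _
  have hL : ∀ g, L g = 0 := by
    have h1 : (Submodule.span ℂ (Set.range (@fourier (2 * Real.pi)))).topologicalClosure ≤
        L.toLinearMap.ker := by
      refine Submodule.topologicalClosure_minimal _ (Submodule.span_le.2 ?_) L.isClosed_ker
      rintro _ ⟨m, rfl⟩
      change ∫ t, fourier m (t : AddCircle (2 * Real.pi)) * w t ∂circleVolume = 0
      rw [← h m]
      congr 1 with t
      rw [fourier_coe_apply]
      congr 2
      have : (Real.pi : ℂ) ≠ 0 := by exact_mod_cast Real.pi_ne_zero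
      push_cast
      field_simp
    intro g
    have := h1 (x := g) (by rw [span_fourier_closure_eq_top]; trivial)
    simpa using this
  have hae : circleVolume = volume.restrict (Set.Ioo (-Real.pi) Real.pi) :=
    Measure.restrict_congr_set Ioo_ae_eq_Ico.symm
  have hloc : LocallyIntegrableOn w (Set.Ioo (-Real.pi) Real.pi) volume := by
    rw [hae] at hw
    exact (show IntegrableOn w _ volume from hw).locallyIntegrableOn
  have key := isOpen_Ioo.ae_eq_zero_of_integral_contDiff_smul_eq_zero hloc (fun g hg hgc hgs => by
    have hval : ∀ x, x ∉ Set.Ioo (-Real.pi) Real.pi → g x = 0 := fun x hx =>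
      image_eq_zero_of_notMem_tsupport fun h' => hx (hgs h')
    -- Both end values are zero, so the test function descends to a continuous function on the
    -- circle.
    have hper : g (-Real.pi) = g (-Real.pi + 2 * Real.pi) := by
      rw [hval _ (by simp), hval _ (by rw [Set.mem_Ioo]; intro h'; linarith [h'.2])]
    let q : C(AddCircle (2 * Real.pi), ℂ) :=
      ⟨fun x => ((AddCircle.liftIco (2 * Real.pi) (-Real.pi) g x : ℝ) : ℂ),
        Complex.continuous_ofReal.comp
          (AddCircle.liftIco_continuous hper hg.continuous.continuousOn)⟩
    have hq : ∫ t, q (t : AddCircle _) * w t ∂circleVolume = 0 := hL q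
    rw [← setIntegral_eq_integral_of_forall_compl_eq_zero (s := Set.Ico (-Real.pi) Real.pi)]
    · rw [← hq, circleVolume]
      refine setIntegral_congr_fun measurableSet_Ico fun t ht => ?_
      have : AddCircle.liftIco (2 * Real.pi) (-Real.pi) g (t : AddCircle (2 * Real.pi)) = g t :=
        AddCircle.liftIco_coe_apply ⟨ht.1, by linarith [ht.2]⟩
      change _ =
        ((AddCircle.liftIco (2 * Real.pi) (-Real.pi) g (t : AddCircle (2 * Real.pi)) : ℝ) : ℂ) * w t
      rw [this, Complex.real_smul]
    · intro x hx
      rw [hval x fun h' => hx (Set.Ioo_subset_Ico_self h'), zero_smul])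
  rw [hae, EventuallyEq, ae_restrict_iff' measurableSet_Ioo]
  exact key

/-! ### Square integrable functions -/

section LTwo

open scoped InnerProductSpace

variable {α : Type*} [MeasurableSpace α] {ν : Measure α}

theorem inner_toLp_toLp {g h : α → ℂ} (hg : MemLp g 2 ν) (hh : MemLp h 2 ν) :
    ⟪hg.toLp g, hh.toLp h⟫_ℂ = ∫ x, h x * starRingEnd ℂ (g x) ∂ν := by
  rw [L2.inner_def]
  refine integral_congr_ae ?_
  filter_upwards [hg.coeFn_toLp, hh.coeFn_toLp] with x h1 h2
  rw [h1, h2, RCLike.inner_apply]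

theorem inner_eq_integral (X Y : Lp ℂ 2 ν) :
    ⟪X, Y⟫_ℂ = ∫ x, Y x * starRingEnd ℂ (X x) ∂ν := by
  rw [L2.inner_def]
  simp only [RCLike.inner_apply]

theorem tendsto_toLp_iff {ι : Type*} {l : Filter ι} {u : ι → α → ℂ} {g : α → ℂ}
    (hu : ∀ i, MemLp (u i) 2 ν) (hg : MemLp g 2 ν) :
    Tendsto (fun i => (hu i).toLp (u i)) l (𝓝 (hg.toLp g)) ↔
      Tendsto (fun i => eLpNorm (fun x => g x - u i x) 2 ν) l (𝓝 0) := by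
  rw [Lp.tendsto_Lp_iff_tendsto_eLpNorm'']
  refine tendsto_congr fun i => ?_
  rw [← eLpNorm_neg]
  refine eLpNorm_congr_ae (Eventually.of_forall fun x => ?_)
  simp

end LTwo

/-! ### Stochastic integrals as isometries -/

section StochasticIntegral

open scoped InnerProductSpace

variable {Ω : Type*} [MeasurableSpace Ω] {P : Measure Ω} {F : Measure ℝ} [IsFiniteMeasure F]

/-- The indicator function of a measurable set in `L²(F)`. -/
def indL2 (F : Measure ℝ) [IsFiniteMeasure F] (A : {A : Set ℝ // MeasurableSet A}) : Lp ℂ 2 F :=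
  indicatorConstLp 2 A.2 (measure_ne_top F A.1) 1

theorem inner_indL2 (A B : {A : Set ℝ // MeasurableSet A}) :
    ⟪indL2 F A, indL2 F B⟫_ℂ = ((F (B.1 ∩ A.1)).toReal : ℂ) := by
  rw [indL2, indL2, L2.inner_indicatorConstLp_one,
    integral_congr_ae (ae_restrict_of_ae indicatorConstLp_coeFn),
    setIntegral_indicator B.2, Set.inter_comm]
  simp [Measure.real]

theorem topologicalClosure_span_indL2 :
    (Submodule.span ℂ (Set.range (indL2 F))).topologicalClosure = ⊤ := by
  rw [eq_top_iff]
  rintro x -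
  refine Lp.induction (by simp) (motive := fun x =>
    x ∈ (Submodule.span ℂ (Set.range (indL2 F))).topologicalClosure) ?_ ?_ ?_ x
  · intro c s hs hμs
    have : (Lp.simpleFunc.indicatorConst 2 hs hμs.ne c : Lp ℂ 2 F) = c • indL2 F ⟨s, hs⟩ := by
      rw [Lp.simpleFunc.coe_indicatorConst, indL2, indicatorConstLp, indicatorConstLp,
        ← MemLp.toLp_const_smul]
      congr 1
      ext t
      by_cases ht : t ∈ s <;> simp [ht]
    rw [this]
    exact Submodule.smul_mem _ _ (Submodule.le_topologicalClosure _ (Submodule.subset_span ⟨_, rfl⟩))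
  · intro f g hf hg _ h1 h2
    exact Submodule.add_mem _ h1 h2
  · exact Submodule.isClosed_topologicalClosure _

theorem toLp_simpleFunc (s : SimpleFunc ℝ ℂ) (hs : MemLp s 2 F) :
    hs.toLp s = ∑ c ∈ s.range, c • indL2 F ⟨s ⁻¹' {c}, s.measurableSet_fiber c⟩ := by
  refine Lp.ext ?_
  have h1 : ∀ᵐ t ∂F, ∀ c ∈ s.range,
      (c • indL2 F ⟨s ⁻¹' {c}, s.measurableSet_fiber c⟩ : Lp ℂ 2 F) t =
        c * (s ⁻¹' {c}).indicator (fun _ => (1 : ℂ)) t := by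
    rw [Finset.eventually_all]
    intro c _
    filter_upwards [Lp.coeFn_smul c (indL2 F ⟨s ⁻¹' {c}, s.measurableSet_fiber c⟩),
      indicatorConstLp_coeFn (p := 2) (hs := s.measurableSet_fiber c)
        (hμs := measure_ne_top F _) (c := (1 : ℂ))] with t h1 h2
    rw [h1, Pi.smul_apply, indL2, h2, smul_eq_mul]
  filter_upwards [hs.coeFn_toLp, h1,
    Lp.coeFn_finsetSum s.range fun c => c • indL2 F ⟨s ⁻¹' {c}, s.measurableSet_fiber c⟩]
    with t h1 h2 h3
  rw [h1, h3, Finset.sum_apply, Finset.sum_congr rfl h2, Finset.sum_eq_single (s t)]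
  · simp
  · intro c _ hc
    rw [Set.indicator_of_notMem, mul_zero]
    simpa using hc.symm
  · intro h
    exact absurd (s.mem_range_self t) h

/-- The covariances of `Z` are the Gram matrix of the indicators. Additivity of `Z` on measurable
sets need not be assumed: it follows from linearity of `J`. -/
theorem exists_isometry_of_orthogonal {Z : Set ℝ → Lp ℂ 2 P}
    (hZ : ∀ A B : Set ℝ, MeasurableSet A → MeasurableSet B →
      ∫ ω, Z A ω * starRingEnd ℂ (Z B ω) ∂P = ((F (A ∩ B)).toReal : ℂ)) :
    ∃ J : Lp ℂ 2 F →ₗᵢ[ℂ] Lp ℂ 2 P, ∀ A, J (indL2 F A) = Z A.1 :=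
  exists_linearIsometry_of_inner_eq (w := fun A : {A : Set ℝ // MeasurableSet A} => Z A.1)
    (fun A B => by rw [inner_indL2, inner_eq_integral, hZ _ _ B.2 A.2])
    topologicalClosure_span_indL2

theorem isometry_toLp_simpleFunc {Z : Set ℝ → Lp ℂ 2 P} {J : Lp ℂ 2 F →ₗᵢ[ℂ] Lp ℂ 2 P}
    (hJ : ∀ A, J (indL2 F A) = Z A.1) (s : SimpleFunc ℝ ℂ) (hs : MemLp s 2 F) :
    J (hs.toLp s) = simpleStochIntegral Z s := by
  rw [toLp_simpleFunc, map_sum, simpleStochIntegral]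
  simp only [map_smul, hJ]

/-- The stochastic integral with respect to `Z` is the isometry that extends `Z`. -/
theorem hasStochIntegral_iff {Z : Set ℝ → Lp ℂ 2 P} {J : Lp ℂ 2 F →ₗᵢ[ℂ] Lp ℂ 2 P}
    (hJ : ∀ A, J (indL2 F A) = Z A.1) (g : ℝ → ℂ) (X : Ω → ℂ) :
    HasStochIntegral F Z g X ↔
      ∃ (hg : MemLp g 2 F) (hX : MemLp X 2 P), J (hg.toLp g) = hX.toLp X := by
  have hs : ∀ s : SimpleFunc ℝ ℂ, MemLp s 2 F := fun s => s.memLp_of_isFiniteMeasure 2 F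
  have key : ∀ (hg : MemLp g 2 F) (hX : MemLp X 2 P) (s : ℕ → SimpleFunc ℝ ℂ),
      (Tendsto (fun j => eLpNorm (fun ω => X ω - simpleStochIntegral Z (s j) ω) 2 P) atTop (𝓝 0) ↔
        Tendsto (fun j => J ((hs (s j)).toLp (s j))) atTop (𝓝 (hX.toLp X))) := by
    intro hg hX s
    rw [← tendsto_toLp_iff (fun j => Lp.memLp (simpleStochIntegral Z (s j))) hX]
    simp only [Lp.toLp_coeFn, isometry_toLp_simpleFunc hJ]
  constructor
  · rintro ⟨hg, hX, s, h1, h2⟩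
    refine ⟨hg, hX, ?_⟩
    have h3 := (tendsto_toLp_iff (fun j => hs (s j)) hg).2 h1
    exact tendsto_nhds_unique ((J.continuous.tendsto _).comp h3) ((key hg hX s).1 h2)
  · rintro ⟨hg, hX, h⟩
    -- Any approximating sequence serves, since the isometry transfers its convergence; the
    -- tolerance `1/(j+1)` fixes one.
    have h1 : ∀ j : ℕ, ∃ s : SimpleFunc ℝ ℂ,
        eLpNorm (g - ⇑s) 2 F < ((j : ℝ≥0∞) + 1)⁻¹ ∧ MemLp s 2 F := fun j =>
      hg.exists_simpleFunc_eLpNorm_sub_lt (by simp) (by simp)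
    choose s h2 _ using h1
    have h3 : Tendsto (fun j => eLpNorm (fun t => g t - s j t) 2 F) atTop (𝓝 0) := by
      refine tendsto_of_tendsto_of_tendsto_of_le_of_le tendsto_const_nhds ?_
        (fun j => zero_le) (fun j => (h2 j).le)
      have := (tendsto_add_atTop_iff_nat 1).2 ENNReal.tendsto_inv_nat_nhds_zero
      simpa using this
    refine ⟨hg, hX, s, h3, (key hg hX s).2 ?_⟩
    rw [← h]
    exact (J.continuous.tendsto _).comp ((tendsto_toLp_iff (fun j => hs (s j)) hg).2 h3)

end StochasticIntegral

/-! ### The kernels of the spectral representation -/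

theorem measurable_transfer (n : ℕ) (s : ℤ) : Measurable (transfer n s) := by
  unfold transfer
  fun_prop

/-- This is `|1 - e^{-ist}| ≤ |s t|`. At `t = 0` the quotient `0 / 0` has the default value `0`, and
the bound survives. -/
theorem norm_transfer_le (n : ℕ) (s : ℤ) (t : ℝ) : ‖transfer n s t‖ ≤ |(s : ℝ)| ^ n := by
  rw [transfer, ← div_pow, norm_pow]
  gcongr
  rw [norm_div, norm_mul, Complex.norm_I, one_mul, Complex.norm_real]
  refine div_le_of_le_mul₀ (norm_nonneg _) (abs_nonneg _) ?_
  have h := Real.norm_exp_I_mul_ofReal_sub_one_le (x := -(s * t))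
  rw [norm_sub_rev, norm_neg, norm_mul, Real.norm_eq_abs (s : ℝ)] at h
  have h2 : Complex.I * ((-(s * t) : ℝ) : ℂ) = -(Complex.I * s * t) := by push_cast; ring
  rwa [h2] at h

/-- The zeros lie in the countable set `2πℤ/s`; the point `0`, where the default value of division
enters, is excluded as well. -/
theorem transfer_ne_zero_ae (n : ℕ) {s : ℤ} (hs : s ≠ 0) :
    ∀ᵐ t ∂circleVolume, transfer n s t ≠ 0 := by
  refine ae_restrict_of_ae ?_
  have hc : (Set.range fun k : ℤ => 2 * Real.pi * k / s).Countable := Set.countable_range _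
  filter_upwards [hc.ae_notMem volume, (Set.countable_singleton (0 : ℝ)).ae_notMem volume]
    with t h1 h2
  have h2' : t ≠ 0 := h2
  rw [transfer, ← div_pow]
  refine pow_ne_zero _ (div_ne_zero (fun h => h1 ?_)
    (mul_ne_zero Complex.I_ne_zero (by exact_mod_cast h2')))
  obtain ⟨k, hk⟩ := Complex.exp_eq_one_iff.1 (sub_eq_zero.1 h).symm
  refine ⟨-k, ?_⟩
  have h3 : (s : ℂ) * t = -(k * (2 * Real.pi)) :=
    mul_left_cancel₀ Complex.I_ne_zero (by linear_combination -hk)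
  have h4 : (s : ℝ) * t = -(k * (2 * Real.pi)) := by exact_mod_cast h3
  have h5 : (s : ℝ) ≠ 0 := by exact_mod_cast hs
  simp only
  push_cast
  rw [div_eq_iff h5]
  linarith

theorem norm_exp_I_mul (t : ℝ) (m : ℤ) : ‖Complex.exp (Complex.I * t * m)‖ = 1 := by
  rw [Complex.norm_exp]
  simp

theorem conj_exp_I_mul (t : ℝ) (m : ℤ) :
    starRingEnd ℂ (Complex.exp (Complex.I * t * m)) = Complex.exp (Complex.I * t * (-m : ℤ)) := by
  rw [← Complex.exp_conj]
  simp

theorem exp_I_mul_add (t : ℝ) (m k : ℤ) :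
    Complex.exp (Complex.I * t * (m + k : ℤ)) =
      Complex.exp (Complex.I * t * m) * Complex.exp (Complex.I * t * k) := by
  rw [← Complex.exp_add]
  push_cast
  ring_nf

theorem memLp_kernel (F : Measure ℝ) [IsFiniteMeasure F] (n : ℕ) (m s : ℤ) :
    MemLp (fun t : ℝ => Complex.exp (Complex.I * t * m) * transfer n s t) 2 F := by
  refine MemLp.of_bound
    ((Measurable.mul (by fun_prop) (measurable_transfer n s)).aestronglyMeasurable)
    (|(s : ℝ)| ^ n) (Eventually.of_forall fun t => ?_)
  rw [norm_mul, norm_exp_I_mul, one_mul]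
  exact norm_transfer_le n s t

/-- The function `e^{itm} (1 - e^{-ist})^n (it)^{-n}` in `L²(F)`. -/
def kernelLp (F : Measure ℝ) [IsFiniteMeasure F] (n : ℕ) (m s : ℤ) : Lp ℂ 2 F :=
  (memLp_kernel F n m s).toLp _

theorem transfer_mul_conj (n : ℕ) (s₁ s₂ : ℤ) (t : ℝ) :
    transfer n s₁ t * starRingEnd ℂ (transfer n s₂ t) =
      (1 - Complex.exp (-(Complex.I * s₁ * t))) ^ n *
        (1 - Complex.exp (Complex.I * s₂ * t)) ^ n * (1 / (t : ℂ) ^ (2 * n)) := by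
  have h1 : starRingEnd ℂ (transfer n s₂ t) =
      (1 - Complex.exp (Complex.I * s₂ * t)) ^ n / (-(Complex.I * t)) ^ n := by
    rw [transfer]
    simp only [map_div₀, map_pow, map_sub, map_one, map_mul, ← Complex.exp_conj, map_neg,
      Complex.conj_I, Complex.conj_ofReal, map_intCast]
    ring_nf
  have h2 : (t : ℂ) ^ (2 * n) = (Complex.I * t) ^ n * (-(Complex.I * t)) ^ n := by
    rw [← mul_pow, pow_mul]
    congr 1
    linear_combination (t : ℂ) ^ 2 * Complex.I_sq
  rw [h1, transfer, h2, div_mul_div_comm, mul_one_div]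

section SpectralMeasure

variable {f : ℝ → ℝ}

theorem spectralMeasure_absolutelyContinuous : spectralMeasure f ≪ circleVolume :=
  withDensity_absolutelyContinuous _ _

theorem isFiniteMeasure_spectralMeasure (hint : Integrable f circleVolume) :
    IsFiniteMeasure (spectralMeasure f) :=
  isFiniteMeasure_withDensity_ofReal (hint.div_const _).2

theorem toReal_density_ae (h0 : ∀ᵐ t ∂circleVolume, 0 ≤ f t) (g : ℝ → ℂ) :
    (fun t => (ENNReal.ofReal (f t / (2 * Real.pi))).toReal • g t) =ᵐ[circleVolume]
      fun t => ((f t / (2 * Real.pi) : ℝ) : ℂ) * g t := by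
  filter_upwards [h0] with t ht
  rw [ENNReal.toReal_ofReal (by positivity), Complex.real_smul]

theorem integrable_spectralMeasure_iff (h0 : ∀ᵐ t ∂circleVolume, 0 ≤ f t)
    (hint : Integrable f circleVolume) (g : ℝ → ℂ) :
    Integrable g (spectralMeasure f) ↔
      Integrable (fun t => ((f t / (2 * Real.pi) : ℝ) : ℂ) * g t) circleVolume := by
  rw [spectralMeasure, integrable_withDensity_iff_integrable_smul₀'
    ((hint.div_const _).aemeasurable.ennreal_ofReal)
    (Eventually.of_forall fun _ => ENNReal.ofReal_lt_top), integrable_congr (toReal_density_ae h0 g)]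

theorem integral_spectralMeasure (h0 : ∀ᵐ t ∂circleVolume, 0 ≤ f t)
    (hint : Integrable f circleVolume) (g : ℝ → ℂ) :
    ∫ t, g t ∂(spectralMeasure f) =
      ∫ t, ((f t / (2 * Real.pi) : ℝ) : ℂ) * g t ∂circleVolume := by
  rw [spectralMeasure, integral_withDensity_eq_integral_toReal_smul₀
    ((hint.div_const _).aemeasurable.ennreal_ofReal)
    (Eventually.of_forall fun _ => ENNReal.ofReal_lt_top), integral_congr_ae (toReal_density_ae h0 g)]

theorem ae_spectralMeasure_iff (h0 : ∀ᵐ t ∂circleVolume, 0 ≤ f t)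
    (hint : Integrable f circleVolume) {p : ℝ → Prop} :
    (∀ᵐ t ∂(spectralMeasure f), p t) ↔ ∀ᵐ t ∂circleVolume, f t ≠ 0 → p t := by
  rw [spectralMeasure, ae_withDensity_iff' ((hint.div_const _).aemeasurable.ennreal_ofReal)]
  refine eventually_congr ?_
  filter_upwards [h0] with t ht
  have : ENNReal.ofReal (f t / (2 * Real.pi)) ≠ 0 ↔ f t ≠ 0 := by
    rw [Ne, ENNReal.ofReal_eq_zero, not_le, ne_comm, ← ht.lt_iff_ne]
    exact div_pos_iff_of_pos_right Real.two_pi_pos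
  rw [this]

theorem ae_eq_zero_of_spectral_fourier_eq_zero (h0 : ∀ᵐ t ∂circleVolume, 0 ≤ f t)
    (hint : Integrable f circleVolume) {w : ℝ → ℂ} (hw : Integrable w (spectralMeasure f))
    (h : ∀ m : ℤ, ∫ t, Complex.exp (Complex.I * t * m) * w t ∂(spectralMeasure f) = 0) :
    w =ᵐ[spectralMeasure f] 0 := by
  have h1 := ae_eq_zero_of_fourier_eq_zero ((integrable_spectralMeasure_iff h0 hint w).1 hw)
    fun m => by
      rw [← h m, integral_spectralMeasure h0 hint]
      congr 1 with t
      ring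
  refine (ae_spectralMeasure_iff h0 hint).2 ?_
  filter_upwards [h1] with t ht hft
  have : ((f t / (2 * Real.pi) : ℝ) : ℂ) ≠ 0 := by
    have := Real.pi_ne_zero
    exact_mod_cast div_ne_zero hft (by positivity)
  exact (mul_eq_zero.1 ht).resolve_left this

/-- If `g` is orthogonal to all kernels of one step `s`, then `g` times the conjugate transfer
function has zero Fourier coefficients with respect to `F`, so it is zero, and the transfer function
can be cancelled. -/
theorem topologicalClosure_span_kernelLp (h0 : ∀ᵐ t ∂circleVolume, 0 ≤ f t)
    (hint : Integrable f circleVolume) [IsFiniteMeasure (spectralMeasure f)] (n : ℕ) {s : ℤ}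
    (hs : s ≠ 0) :
    (Submodule.span ℂ (Set.range fun m : ℤ => kernelLp (spectralMeasure f) n m s)).topologicalClosure
      = ⊤ := by
  rw [Submodule.topologicalClosure_eq_top_iff, Submodule.eq_bot_iff]
  intro g hg
  have hT : MemLp (fun t => starRingEnd ℂ (transfer n s t)) 2 (spectralMeasure f) := by
    refine MemLp.of_bound
      (Complex.continuous_conj.measurable.comp (measurable_transfer n s)).aestronglyMeasurable
      (|(s : ℝ)| ^ n) (Eventually.of_forall fun t => ?_)
    rw [RCLike.norm_conj]
    exact norm_transfer_le n s t
  have h1 := ae_eq_zero_of_spectral_fourier_eq_zero h0 hint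
    (w := fun t => g t * starRingEnd ℂ (transfer n s t)) ((Lp.memLp g).integrable_mul hT) fun m => by
      have h2 := Submodule.inner_right_of_mem_orthogonal
        (Submodule.subset_span (R := ℂ) (s := Set.range fun m : ℤ => kernelLp (spectralMeasure f) n m s)
          -- The inner product conjugates its first argument, so frequency `m` comes from the kernel
          -- at time `-m`.
          ⟨-m, rfl⟩) hg
      rw [← h2, ← Lp.toLp_coeFn g (Lp.memLp g)]
      simp only [kernelLp]
      rw [inner_toLp_toLp, Lp.toLp_coeFn]
      congr 1 with t
      rw [map_mul, conj_exp_I_mul, neg_neg]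
      ring
  rw [Lp.eq_zero_iff_ae_eq_zero]
  filter_upwards [h1, spectralMeasure_absolutelyContinuous.ae_le (transfer_ne_zero_ae n hs)]
    with t ht hne
  exact (mul_eq_zero.1 ht).resolve_right (by simpa using hne)

end SpectralMeasure

/-! ### The isometry between the spectral domain and the increments -/

theorem closedSpan_eq {Ω ι : Type*} [MeasurableSpace Ω] {P : Measure Ω} {X : ι → Ω → ℂ}
    (hX : ∀ i, MemLp (X i) 2 P) (S : Set ι) :
    closedSpan P X S =
      (Submodule.span ℂ ((fun i => (hX i).toLp (X i)) '' S)).topologicalClosure := by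
  rw [closedSpan]
  congr 2
  ext Y
  refine exists_congr fun i => and_congr_right fun _ => ?_
  constructor
  · intro h
    exact (Lp.ext ((hX i).coeFn_toLp.trans h.symm))
  · rintro rfl
    exact (hX i).coeFn_toLp

theorem toLp_sum_mul {α ι : Type*} [MeasurableSpace α] {ν : Measure α} (s : Finset ι) (c : ι → ℂ)
    {X : ι → α → ℂ} (hX : ∀ i, MemLp (X i) 2 ν) (h : MemLp (fun x => ∑ i ∈ s, c i * X i x) 2 ν) :
    h.toLp _ = ∑ i ∈ s, c i • (hX i).toLp (X i) := by
  refine Lp.ext ?_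
  have h1 : ∀ᵐ x ∂ν, ∀ i ∈ s, (c i • (hX i).toLp (X i) : Lp ℂ 2 ν) x = c i * X i x := by
    rw [Finset.eventually_all]
    intro i _
    filter_upwards [Lp.coeFn_smul (c i) ((hX i).toLp (X i)), (hX i).coeFn_toLp] with x h1 h2
    rw [h1, Pi.smul_apply, h2, smul_eq_mul]
  filter_upwards [h.coeFn_toLp, h1, Lp.coeFn_finsetSum s fun i => c i • (hX i).toLp (X i)]
    with x h1 h2 h3
  rw [h1, h3, Finset.sum_apply, Finset.sum_congr rfl h2]

theorem memLp_exp_mul {F : Measure ℝ} (j : ℤ) {g : ℝ → ℂ} (hg : MemLp g 2 F) :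
    MemLp (fun t : ℝ => Complex.exp (Complex.I * t * j) * g t) 2 F := by
  refine hg.of_le (AEStronglyMeasurable.mul
    (Measurable.aestronglyMeasurable (by fun_prop)) hg.1) (Eventually.of_forall fun t => ?_)
  rw [norm_mul, norm_exp_I_mul, one_mul]

/-- Multiplication by `e^{itj}` on `L²(F)`. -/
def shiftLp (F : Measure ℝ) (j : ℤ) : Lp ℂ 2 F →ₗᵢ[ℂ] Lp ℂ 2 F where
  toFun g := (memLp_exp_mul j (Lp.memLp g)).toLp _
  map_add' g h := by
    rw [← MemLp.toLp_add]
    refine MemLp.toLp_congr _ _ ?_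
    filter_upwards [Lp.coeFn_add g h] with t ht
    rw [ht]
    exact mul_add _ _ _
  map_smul' c g := by
    rw [RingHom.id_apply, ← MemLp.toLp_const_smul]
    refine MemLp.toLp_congr _ _ ?_
    filter_upwards [Lp.coeFn_smul c g] with t ht
    rw [ht]
    exact mul_left_comm _ _ _
  norm_map' g := by
    change ‖(memLp_exp_mul j (Lp.memLp g)).toLp _‖ = _
    rw [Lp.norm_toLp, Lp.norm_def]
    congr 1
    refine eLpNorm_congr_norm_ae (Eventually.of_forall fun t => ?_)
    rw [norm_mul, norm_exp_I_mul, one_mul]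

theorem shiftLp_toLp {F : Measure ℝ} (j : ℤ) {g : ℝ → ℂ} (hg : MemLp g 2 F) :
    shiftLp F j (hg.toLp g) = (memLp_exp_mul j hg).toLp _ := by
  refine MemLp.toLp_congr (memLp_exp_mul j (Lp.memLp _)) _ ?_
  filter_upwards [hg.coeFn_toLp] with t ht
  rw [ht]

theorem shiftLp_eq {F : Measure ℝ} (j : ℤ) (g : Lp ℂ 2 F) :
    shiftLp F j g = (memLp_exp_mul j (Lp.memLp g)).toLp _ := rfl

theorem shiftLp_kernelLp (F : Measure ℝ) [IsFiniteMeasure F] (n : ℕ) (j m s : ℤ) :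
    shiftLp F j (kernelLp F n m s) = kernelLp F n (m + j) s := by
  rw [kernelLp, shiftLp_toLp]
  refine MemLp.toLp_congr _ _ (Eventually.of_forall fun t => ?_)
  simp only [exp_I_mul_add]
  ring

section Isometry

open scoped InnerProductSpace

variable {Ω : Type*} [MeasurableSpace Ω] {P : Measure Ω} {n : ℕ} {ξ : ℤ → Ω → ℂ} {f : ℝ → ℝ}
  [IsFiniteMeasure (spectralMeasure f)]

theorem topologicalClosure_span_kernelLp_all (hf : IsSpectralDensity P n ξ f) :
    (Submodule.span ℂ (Set.range fun p : ℤ × ℤ =>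
      kernelLp (spectralMeasure f) n p.1 p.2)).topologicalClosure = ⊤ := by
  rw [eq_top_iff, ← topologicalClosure_span_kernelLp hf.nonneg hf.integrable n one_ne_zero]
  refine Submodule.topologicalClosure_mono (Submodule.span_mono ?_)
  rintro _ ⟨m, rfl⟩
  exact ⟨(m, 1), rfl⟩

/-- Kolmogorov's isomorphism: the structural function is the common Gram matrix of the kernels and
the increments. -/
theorem exists_spectralIsometry (hξ : HasStationaryIncrements P n ξ)
    (hf : IsSpectralDensity P n ξ f) :
    ∃ J : Lp ℂ 2 (spectralMeasure f) →ₗᵢ[ℂ] Lp ℂ 2 P,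
      ∀ m s, J (kernelLp (spectralMeasure f) n m s) = (hξ.memLp m s).toLp _ := by
  obtain ⟨J, hJ⟩ := exists_linearIsometry_of_inner_eq
    (u := fun p : ℤ × ℤ => kernelLp (spectralMeasure f) n p.1 p.2)
    (w := fun p : ℤ × ℤ => (hξ.memLp p.1 p.2).toLp _) (fun p q => by
      simp only [kernelLp]
      rw [inner_toLp_toLp, inner_toLp_toLp]
      -- The roles of `p` and `q` are exchanged because the conjugated factor stands second in the
      -- covariance and first in the inner product.
      have h := hf.structural p.1 (q.1 - p.1) q.2 p.2
      rw [add_sub_cancel] at h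
      rw [h]
      congr 1 with t
      rw [map_mul, conj_exp_I_mul, sub_eq_add_neg, exp_I_mul_add]
      linear_combination Complex.exp (Complex.I * t * q.1) *
        Complex.exp (Complex.I * t * (-p.1 : ℤ)) * transfer_mul_conj n q.2 p.2 t)
    (topologicalClosure_span_kernelLp_all hf)
  exact ⟨J, fun m s => hJ (m, s)⟩

variable {J : Lp ℂ 2 (spectralMeasure f) →ₗᵢ[ℂ] Lp ℂ 2 P}

theorem exists_spectralRepresentation (hξ : HasStationaryIncrements P n ξ)
    (hJ : ∀ m s, J (kernelLp (spectralMeasure f) n m s) = (hξ.memLp m s).toLp _) :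
    ∃ Z : Set ℝ → Lp ℂ 2 P, IsSpectralRepresentation n ξ (spectralMeasure f) Z := by
  classical
  let Z : Set ℝ → Lp ℂ 2 P := fun A =>
    if h : MeasurableSet A then J (indL2 (spectralMeasure f) ⟨A, h⟩) else 0
  have hZ : ∀ A : {A : Set ℝ // MeasurableSet A}, J (indL2 (spectralMeasure f) A) = Z A.1 :=
    fun A => by simp only [Z, dif_pos A.2]
  refine ⟨Z, fun A B hA hB => ?_, fun m s => ?_⟩
  · rw [← inner_eq_integral, ← hZ ⟨A, hA⟩, ← hZ ⟨B, hB⟩, J.inner_map_map, inner_indL2]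
  · exact (hasStochIntegral_iff hZ _ _).2 ⟨memLp_kernel _ n m s, hξ.memLp m s, hJ m s⟩

/-- The isometry that extends `Z` agrees with `J` on the kernels, and these are total. Thus `Z` is
determined on measurable sets, and formulas proved with `J` hold for every `Z`. -/
theorem isometry_indL2_of_representation (hξ : HasStationaryIncrements P n ξ)
    (hf : IsSpectralDensity P n ξ f)
    (hJ : ∀ m s, J (kernelLp (spectralMeasure f) n m s) = (hξ.memLp m s).toLp _)
    {Z : Set ℝ → Lp ℂ 2 P} (hZ : IsSpectralRepresentation n ξ (spectralMeasure f) Z)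
    (A : {A : Set ℝ // MeasurableSet A}) : J (indL2 (spectralMeasure f) A) = Z A.1 := by
  obtain ⟨K, hK⟩ := exists_isometry_of_orthogonal hZ.orthogonal
  have : J = K := linearIsometry_ext_of_total (topologicalClosure_span_kernelLp_all hf) fun p => by
    obtain ⟨hg, hX, h⟩ := (hasStochIntegral_iff hK _ _).1 (hZ.represents p.1 p.2)
    exact (hJ p.1 p.2).trans h.symm
  rw [this, hK]

end Isometry

/-! ### Trigonometric integrals -/

theorem integral_circleVolume (g : ℝ → ℂ) :
    ∫ t, g t ∂circleVolume = ∫ t in (-Real.pi)..Real.pi, g t := by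
  rw [intervalIntegral.integral_of_le (by linarith [Real.pi_pos]), circleVolume,
    integral_Ico_eq_integral_Ioo, integral_Ioc_eq_integral_Ioo]

theorem integral_exp_circleVolume (m : ℤ) :
    ∫ t : ℝ, Complex.exp (Complex.I * t * m) ∂circleVolume =
      if m = 0 then ((2 * Real.pi : ℝ) : ℂ) else 0 := by
  rw [integral_circleVolume]
  split_ifs with h
  · subst h
    simp
    ring
  · have hc : Complex.I * m ≠ 0 := mul_ne_zero Complex.I_ne_zero (by exact_mod_cast h)
    have h1 : ∀ t : ℝ, Complex.exp (Complex.I * t * m) = Complex.exp (Complex.I * m * t) := by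
      intro t; ring_nf
    simp_rw [h1]
    rw [integral_exp_mul_complex hc, div_eq_zero_iff]
    left
    rw [sub_eq_zero, Complex.exp_eq_exp_iff_exists_int]
    refine ⟨m, ?_⟩
    push_cast
    ring

/-! ### Innovations in the spectral domain -/

section Innovation

open scoped InnerProductSpace

variable {Ω : Type*} [MeasurableSpace Ω] {P : Measure Ω} {n : ℕ} {ξ ε : ℤ → Ω → ℂ} {f : ℝ → ℝ}
  [IsFiniteMeasure (spectralMeasure f)]
  {J : Lp ℂ 2 (spectralMeasure f) →ₗᵢ[ℂ] Lp ℂ 2 P}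

theorem orthonormal_innovation (hε : IsInnovation P n ξ ε) :
    Orthonormal ℂ fun m => (hε.memLp m).toLp (ε m) := by
  rw [orthonormal_iff_ite]
  intro i j
  rw [inner_toLp_toLp, hε.cov]
  simp only [eq_comm]

/-- The generators of the past of the increments in the spectral domain. -/
def pastKernels (f : ℝ → ℝ) [IsFiniteMeasure (spectralMeasure f)] (n : ℕ) (t : ℤ) :
    Set (Lp ℂ 2 (spectralMeasure f)) :=
  (fun p : ℤ × ℤ => kernelLp (spectralMeasure f) n p.1 p.2) '' {p | p.1 ≤ t ∧ 0 < p.2}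

theorem shiftLp_image_pastKernels (t j : ℤ) :
    shiftLp (spectralMeasure f) j '' pastKernels f n t = pastKernels f n (t + j) := by
  rw [pastKernels, pastKernels, Set.image_image]
  simp only [shiftLp_kernelLp]
  ext x
  constructor
  · rintro ⟨p, ⟨h1, h2⟩, rfl⟩
    exact ⟨(p.1 + j, p.2), ⟨by simpa using h1, h2⟩, rfl⟩
  · rintro ⟨p, ⟨h1, h2⟩, rfl⟩
    exact ⟨(p.1 - j, p.2), ⟨by simpa using h1, h2⟩, by simp⟩

/-- Each `ε(m)` is a limit of combinations of increments, and the range of `J` contains these and is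
closed, being an isometric image of a complete space. So innovations and pasts can be pulled back.
-/
theorem exists_spectral_innovations (hξ : HasStationaryIncrements P n ξ)
    (hJ : ∀ m s, J (kernelLp (spectralMeasure f) n m s) = (hξ.memLp m s).toLp _)
    (hε : IsInnovation P n ξ ε) :
    ∃ g : ℤ → Lp ℂ 2 (spectralMeasure f), (∀ m, J (g m) = (hε.memLp m).toLp (ε m)) ∧
      Orthonormal ℂ g ∧ ∀ t, (Submodule.span ℂ (pastKernels f n t)).topologicalClosure =
        (Submodule.span ℂ (g '' Set.Iic t)).topologicalClosure := by
  have himg : ∀ t, J '' pastKernels f n t =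
      (fun p : ℤ × ℤ => (hξ.memLp p.1 p.2).toLp _) '' {p | p.1 ≤ t ∧ 0 < p.2} := fun t => by
    rw [pastKernels, Set.image_image]
    simp only [hJ]
  have hpast := fun t => hε.past t
  simp only [closedSpan_eq hε.memLp] at hpast
  simp only [closedSpan_eq (X := fun p : ℤ × ℤ => incr n ξ p.1 p.2)
    (fun p => hξ.memLp p.1 p.2)] at hpast
  have hrange : ∀ m, ∃ x, J x = (hε.memLp m).toLp (ε m) := by
    intro m
    have h1 : (hε.memLp m).toLp (ε m) ∈
        (Submodule.span ℂ (J '' pastKernels f n m)).topologicalClosure := by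
      rw [himg, hpast]
      exact Submodule.le_topologicalClosure _ (Submodule.subset_span ⟨m, le_refl m, rfl⟩)
    have h2 : (Submodule.span ℂ (J '' pastKernels f n m)).topologicalClosure ≤
        J.toLinearMap.range := by
      refine Submodule.topologicalClosure_minimal _ (Submodule.span_le.2 ?_) ?_
      · rintro _ ⟨x, _, rfl⟩
        exact ⟨x, rfl⟩
      · exact J.isometry.isClosedEmbedding.isClosed_range
    exact h2 h1
  choose g hg using hrange
  refine ⟨g, hg, ?_, fun t => ?_⟩
  · have h := orthonormal_innovation hε
    rw [orthonormal_iff_ite] at h ⊢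
    intro i j
    rw [← h i j, ← hg, ← hg, J.inner_map_map]
  · ext x
    rw [← mem_topologicalClosure_span_image_iff J, ← mem_topologicalClosure_span_image_iff J, himg,
      hpast, Set.image_image]
    simp only [hg]
    rfl

theorem tendsto_spectral_movingAverage {μ : ℕ} {φ : ℕ → ℂ} (hξ : HasStationaryIncrements P n ξ)
    (hJ : ∀ m s, J (kernelLp (spectralMeasure f) n m s) = (hξ.memLp m s).toLp _)
    (hMA : IsCanonicalMovingAverage P n μ ξ ε φ) {g : ℤ → Lp ℂ 2 (spectralMeasure f)}
    (hg : ∀ m, J (g m) = (hMA.innovation.memLp m).toLp (ε m)) (m : ℤ) :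
    Tendsto (fun K : ℕ => ∑ k ∈ Finset.range K, φ k • g (m - k)) atTop
      (𝓝 (kernelLp (spectralMeasure f) n m μ)) := by
  have hmem : ∀ K : ℕ, MemLp (fun ω => ∑ k ∈ Finset.range K, φ k * ε (m - k) ω) 2 P := fun K =>
    memLp_finsetSum _ fun k _ => (hMA.innovation.memLp _).const_mul _
  have h1 := (tendsto_toLp_iff hmem (hξ.memLp m μ)).2 (hMA.hasSum m)
  rw [J.isometry.isEmbedding.tendsto_nhds_iff, hJ]
  refine h1.congr fun K => ?_
  rw [toLp_sum_mul _ _ (fun k : ℕ => hMA.innovation.memLp (m - k)), Function.comp_apply, map_sum]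
  simp only [map_smul, hg]

/-- The coefficients of an orthonormal expansion are inner products; what matters later is that they
are the same for all `m`. -/
theorem inner_innovation_kernelLp {μ : ℕ} {φ : ℕ → ℂ} {g : ℤ → Lp ℂ 2 (spectralMeasure f)}
    (hg : Orthonormal ℂ g) (hlim : ∀ m : ℤ,
      Tendsto (fun K : ℕ => ∑ k ∈ Finset.range K, φ k • g (m - k)) atTop
        (𝓝 (kernelLp (spectralMeasure f) n m μ))) (m : ℤ) (k : ℕ) :
    ⟪g (m - k), kernelLp (spectralMeasure f) n m μ⟫_ℂ = φ k := by
  have h1 : Tendsto (fun K : ℕ => ⟪g (m - k), ∑ k ∈ Finset.range K, φ k • g (m - k)⟫_ℂ) atTop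
      (𝓝 ⟪g (m - k), kernelLp (spectralMeasure f) n m μ⟫_ℂ) :=
    tendsto_const_nhds.inner (hlim m)
  refine tendsto_nhds_unique h1 (tendsto_const_nhds.congr' ?_)
  filter_upwards [eventually_gt_atTop k] with K hK
  rw [inner_sum, Finset.sum_eq_single_of_mem k (Finset.mem_range.2 hK)]
  · rw [inner_smul_right, inner_self_eq_norm_sq_to_K, hg.1]
    simp
  · intro l _ hl
    rw [inner_smul_right, hg.2 (by simpa using hl.symm), mul_zero]

/-- Innovation spaces are one-dimensional, so the shift of `g 0` is `c • g j`. Comparing the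
coefficients of the kernels at times `k` and `k + j` gives `φ k = conj c * φ k`, and some `φ k` is
nonzero. -/
theorem spectral_innovation_eq_shift {μ : ℕ} (hμ : 0 < μ) {φ : ℕ → ℂ}
    {g : ℤ → Lp ℂ 2 (spectralMeasure f)} (hg : Orthonormal ℂ g)
    (hspan : ∀ t, (Submodule.span ℂ (pastKernels f n t)).topologicalClosure =
        (Submodule.span ℂ (g '' Set.Iic t)).topologicalClosure)
    (hlim : ∀ m : ℤ, Tendsto (fun K : ℕ => ∑ k ∈ Finset.range K, φ k • g (m - k)) atTop
        (𝓝 (kernelLp (spectralMeasure f) n m μ))) (j : ℤ) :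
    shiftLp (spectralMeasure f) j (g 0) = g j := by
  -- If all coefficients vanished, the transfer function would be zero `F`-almost everywhere; then
  -- `F = 0`, against `‖g 0‖ = 1`.
  have hφ : ∃ k, φ k ≠ 0 := by
    by_contra! h
    have h1 : kernelLp (spectralMeasure f) n 0 μ = 0 := by
      refine tendsto_nhds_unique (hlim 0) ?_
      simp [h]
    rw [Lp.eq_zero_iff_ae_eq_zero] at h1
    have h2 : ∀ᵐ t ∂(spectralMeasure f), False := by
      filter_upwards [h1, (memLp_kernel (spectralMeasure f) n 0 μ).coeFn_toLp,
        spectralMeasure_absolutelyContinuous.ae_le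
          (transfer_ne_zero_ae n (s := μ) (by exact_mod_cast hμ.ne'))] with t h3 h5 h4
      rw [kernelLp, h5] at h3
      exact (mul_ne_zero (Complex.exp_ne_zero _) h4) h3
    have h3 : g 0 = 0 := by
      rw [Lp.eq_zero_iff_ae_eq_zero]
      exact h2.mono fun t ht => ht.elim
    have := hg.1 0
    simp [h3] at this
  obtain ⟨k, hk⟩ := hφ
  have h1 := shift_innovation_eq_smul hg hspan (shiftLp (spectralMeasure f) j) j
    fun t => shiftLp_image_pastKernels t j
  set c := ⟪g j, shiftLp (spectralMeasure f) j (g 0)⟫_ℂ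
  have h2 : φ k = starRingEnd ℂ c * φ k := by
    have h3 := inner_innovation_kernelLp hg hlim k k
    rw [sub_self, ← (shiftLp (spectralMeasure f) j).inner_map_map, h1, shiftLp_kernelLp,
      inner_smul_left] at h3
    have h4 := inner_innovation_kernelLp hg hlim (k + j) k
    rw [add_sub_cancel_left] at h4
    rw [h4] at h3
    exact h3.symm
  have h3 : c = 1 := by
    have : starRingEnd ℂ c = 1 := mul_right_cancel₀ hk (by rw [one_mul]; exact h2.symm)
    simpa using congrArg (starRingEnd ℂ) this
  rw [h1, h3, one_smul]

end Innovation

-- By orthonormality, `f |g|² / (2π)` has the Fourier coefficients of the constant `1 / (2π)`. The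
-- conclusion holds Lebesgue-almost everywhere, so it also shows that `f` is almost nowhere zero.
open scoped InnerProductSpace in
theorem density_mul_norm_sq_ae {f : ℝ → ℝ} (h0 : ∀ᵐ t ∂circleVolume, 0 ≤ f t)
    (hint : Integrable f circleVolume) {g : Lp ℂ 2 (spectralMeasure f)}
    (hg : ∀ j : ℤ, ⟪g, shiftLp (spectralMeasure f) j g⟫_ℂ = if j = 0 then 1 else 0) :
    ∀ᵐ t ∂circleVolume, ((f t : ℝ) : ℂ) * (g t * starRingEnd ℂ (g t)) = 1 := by
  have hgi : Integrable (fun t => g t * starRingEnd ℂ (g t)) (spectralMeasure f) :=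
    (Lp.memLp g).integrable_mul (Lp.memLp g).star
  have h1 : ∀ m : ℤ, ∫ t, Complex.exp (Complex.I * t * m) *
      (((f t / (2 * Real.pi) : ℝ) : ℂ) * (g t * starRingEnd ℂ (g t))) ∂circleVolume =
        if m = 0 then 1 else 0 := fun m => by
    rw [← hg m, shiftLp_eq]
    nth_rw 3 [← Lp.toLp_coeFn g (Lp.memLp g)]
    rw [inner_toLp_toLp, integral_spectralMeasure h0 hint]
    congr 1 with t
    ring
  have hi1 := (integrable_spectralMeasure_iff h0 hint _).1 hgi
  have hexp : ∀ (m : ℤ) {w : ℝ → ℂ}, Integrable w circleVolume →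
      Integrable (fun t : ℝ => Complex.exp (Complex.I * t * m) * w t) circleVolume := fun m w hw =>
    hw.bdd_mul (c := 1) (Measurable.aestronglyMeasurable (by fun_prop))
      (Eventually.of_forall fun t => (norm_exp_I_mul t m).le)
  have hpi : (2 * Real.pi : ℂ) ≠ 0 := by
    have := Real.pi_ne_zero
    exact_mod_cast mul_ne_zero two_ne_zero this
  have h2 := ae_eq_zero_of_fourier_eq_zero
    (w := fun t => ((f t / (2 * Real.pi) : ℝ) : ℂ) * (g t * starRingEnd ℂ (g t)) -
      1 / (2 * Real.pi)) (hi1.sub (integrable_const _)) fun m => by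
    simp_rw [mul_sub]
    rw [integral_sub (hexp m hi1) (hexp m (integrable_const _)), h1, integral_mul_const,
      integral_exp_circleVolume]
    split_ifs
    · push_cast
      rw [mul_one_div_cancel hpi, sub_self]
    · simp
  filter_upwards [h2] with t ht
  have h3 : (((f t / (2 * Real.pi) : ℝ) : ℂ) * (g t * starRingEnd ℂ (g t)) -
      1 / (2 * Real.pi)) = 0 := ht
  push_cast at h3
  field_simp at h3
  linear_combination h3

/-! ### The boundary function -/

open scoped InnerProductSpace in
theorem orthonormal_expL2 :
    Orthonormal ℂ fun k => (((Real.sqrt (2 * Real.pi))⁻¹ : ℝ) : ℂ) • expL2 k := by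
  rw [orthonormal_iff_ite]
  intro i j
  rw [inner_smul_left, inner_smul_right, expL2, expL2, inner_toLp_toLp]
  have h1 : ∀ t : ℝ, Complex.exp (-(Complex.I * t * j)) *
      starRingEnd ℂ (Complex.exp (-(Complex.I * t * i))) =
        Complex.exp (Complex.I * t * ((i : ℤ) - (j : ℤ) : ℤ)) := fun t => by
    rw [← Complex.exp_conj, ← Complex.exp_add]
    simp only [map_neg, map_mul, Complex.conj_I, Complex.conj_ofReal, map_natCast]
    push_cast
    ring_nf
  simp_rw [h1]
  rw [integral_exp_circleVolume]
  have h2 : (Real.sqrt (2 * Real.pi))⁻¹ * ((Real.sqrt (2 * Real.pi))⁻¹ * (2 * Real.pi)) = 1 := by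
    have h3 := Real.mul_self_sqrt Real.two_pi_pos.le
    have h4 : Real.sqrt (2 * Real.pi) ≠ 0 := (Real.sqrt_pos.2 Real.two_pi_pos).ne'
    generalize Real.sqrt (2 * Real.pi) = r at h3 h4
    rw [← h3]
    field_simp
  by_cases h : i = j
  · rw [if_pos (by omega), if_pos h, Complex.conj_ofReal]
    exact_mod_cast h2
  · rw [if_neg (by omega), if_neg h]
    simp

/-- The exponentials are orthogonal of norm `√(2π)`, so square summability suffices; the `tsum` in
`boundary` is then a genuine sum and not its default value `0`. -/
theorem hasSum_boundary {φ : ℕ → ℂ} (hφ : Summable fun k => ‖φ k‖ ^ 2) :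
    HasSum (fun k => φ k • expL2 k) (boundary φ) := by
  refine Summable.hasSum ?_
  have h1 := (orthonormal_expL2.orthogonalFamily.summable_iff_norm_sq_summable fun k => φ k).2 hφ
  simp only [LinearIsometry.toSpanSingleton_apply] at h1
  have h2 := h1.const_smul ((Real.sqrt (2 * Real.pi) : ℝ) : ℂ)
  refine h2.congr fun k => ?_
  have h4 : ((Real.sqrt (2 * Real.pi) : ℝ) : ℂ) ≠ 0 := by
    exact_mod_cast (Real.sqrt_pos.2 Real.two_pi_pos).ne'
  rw [smul_comm (φ k), smul_smul, Complex.ofReal_inv, mul_inv_cancel₀ h4, one_smul]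

/-- Multiplication by the possibly unbounded `g` is not continuous in `L²`, so the limits are
compared pointwise, along a common subsequence on which both converge almost everywhere. -/
theorem ae_eq_of_tendsto_Lp_of_tendsto_Lp {α : Type*} [MeasurableSpace α] {ν ν' : Measure α}
    (hν : ν' ≪ ν) {u : ℕ → Lp ℂ 2 ν} {x : Lp ℂ 2 ν} {v : ℕ → Lp ℂ 2 ν'} {y : Lp ℂ 2 ν'}
    (hu : Tendsto u atTop (𝓝 x)) (hv : Tendsto v atTop (𝓝 y)) {g : α → ℂ}
    (huv : ∀ k, v k =ᵐ[ν'] fun t => u k t * g t) : y =ᵐ[ν'] fun t => x t * g t := by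
  obtain ⟨ns, hns, h1⟩ := (tendstoInMeasure_of_tendsto_Lp hu).exists_seq_tendsto_ae
  have hv' : Tendsto (fun i => v (ns i)) atTop (𝓝 y) := hv.comp hns.tendsto_atTop
  obtain ⟨ms, hms, h2⟩ := (tendstoInMeasure_of_tendsto_Lp hv').exists_seq_tendsto_ae
  filter_upwards [hν.ae_le h1, h2, ae_all_iff.2 huv] with t h3 h4 h5
  refine tendsto_nhds_unique h4 ?_
  simp only [h5]
  exact (h3.comp hms.tendsto_atTop).mul_const _

theorem coeFn_sum_smul_expL2 (φ : ℕ → ℂ) (K : ℕ) :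
    (∑ k ∈ Finset.range K, φ k • expL2 k : Lp ℂ 2 circleVolume) =ᵐ[circleVolume] fun t =>
      ∑ k ∈ Finset.range K, φ k * Complex.exp (-(Complex.I * t * k)) := by
  have hX : ∀ k : ℕ, MemLp (fun t : ℝ => Complex.exp (-(Complex.I * t * k))) 2 circleVolume :=
    fun k => MemLp.of_bound (Continuous.aestronglyMeasurable (by fun_prop)) 1
      (Eventually.of_forall fun t => by rw [Complex.norm_exp]; simp)
  have h := memLp_finsetSum (Finset.range K) fun k _ => (hX k).const_mul (φ k)
  have h1 := toLp_sum_mul (Finset.range K) φ hX h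
  have h2 : ∀ k, (hX k).toLp _ = expL2 k := fun k => rfl
  simp only [h2] at h1
  rw [← h1]
  exact h.coeFn_toLp

theorem coeFn_sum_smul_shiftLp {f : ℝ → ℝ} (φ : ℕ → ℂ) (g : Lp ℂ 2 (spectralMeasure f)) (K : ℕ) :
    (∑ k ∈ Finset.range K, φ k • shiftLp (spectralMeasure f) (-k) g :
        Lp ℂ 2 (spectralMeasure f)) =ᵐ[spectralMeasure f] fun t =>
      ∑ k ∈ Finset.range K, φ k * Complex.exp (-(Complex.I * t * k)) * g t := by
  have hX : ∀ k : ℕ, MemLp (fun t : ℝ => Complex.exp (Complex.I * t * (-k : ℤ)) * g t) 2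
      (spectralMeasure f) := fun k => memLp_exp_mul _ (Lp.memLp g)
  have h := memLp_finsetSum (Finset.range K) fun k _ => (hX k).const_mul (φ k)
  have h1 := toLp_sum_mul (Finset.range K) φ hX h
  simp only [shiftLp_eq]
  rw [← h1]
  refine h.coeFn_toLp.trans (Eventually.of_forall fun t => Finset.sum_congr rfl fun k _ => ?_)
  push_cast
  ring_nf

section Transfer

variable {n : ℕ} {f : ℝ → ℝ} [IsFiniteMeasure (spectralMeasure f)]

/-- The spectral characteristic of the innovation, times the boundary function of the moving
average, is the transfer function. -/
theorem transfer_eq_boundary_mul_ae {μ : ℕ} {φ : ℕ → ℂ} (hφ : Summable fun k => ‖φ k‖ ^ 2)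
    {g : Lp ℂ 2 (spectralMeasure f)}
    (hlim : Tendsto (fun K : ℕ => ∑ k ∈ Finset.range K, φ k • shiftLp (spectralMeasure f) (-k) g)
      atTop (𝓝 (kernelLp (spectralMeasure f) n 0 μ))) :
    ∀ᵐ t ∂(spectralMeasure f), transfer n μ t = boundary φ t * g t := by
  have h := ae_eq_of_tendsto_Lp_of_tendsto_Lp (g := g) spectralMeasure_absolutelyContinuous
    (hasSum_boundary hφ).tendsto_sum_nat hlim fun K => by
      filter_upwards [coeFn_sum_smul_shiftLp φ g K,
        spectralMeasure_absolutelyContinuous.ae_le (coeFn_sum_smul_expL2 φ K)] with t h1 h2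
      rw [h1, h2, Finset.sum_mul]
  filter_upwards [h, (memLp_kernel (spectralMeasure f) n 0 μ).coeFn_toLp] with t h1 h2
  rw [← h1, kernelLp, h2]
  simp

variable {Ω : Type*} [MeasurableSpace Ω] {P : Measure Ω} {ξ ε : ℤ → Ω → ℂ}

/-- The innovations in the spectral domain: `ε(j) = ∫ e^{itj} g(t) dZ(t)`, where
`g = (1 - e^{-itμ})^n (it)^{-n} / Φ_μ(e^{-it})`; in particular the spectral density vanishes almost
nowhere. -/
theorem exists_innovation_kernel {J : Lp ℂ 2 (spectralMeasure f) →ₗᵢ[ℂ] Lp ℂ 2 P}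
    {μ : ℕ} (hμ : 0 < μ) {φ : ℕ → ℂ} (hξ : HasStationaryIncrements P n ξ)
    (hf : IsSpectralDensity P n ξ f)
    (hJ : ∀ m s, J (kernelLp (spectralMeasure f) n m s) = (hξ.memLp m s).toLp _)
    (hMA : IsCanonicalMovingAverage P n μ ξ ε φ) :
    ∃ g : Lp ℂ 2 (spectralMeasure f),
      (∀ j, J (shiftLp (spectralMeasure f) j g) = (hMA.innovation.memLp j).toLp (ε j)) ∧
      (∀ᵐ t ∂circleVolume, f t ≠ 0) ∧
      ∀ᵐ t ∂(spectralMeasure f), g t = transfer n μ t * (boundary φ t)⁻¹ := by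
  obtain ⟨g, hg, hon, hspan⟩ := exists_spectral_innovations hξ hJ hMA.innovation
  have hlim := tendsto_spectral_movingAverage hξ hJ hMA hg
  have hshift := spectral_innovation_eq_shift hμ hon hspan hlim
  refine ⟨g 0, fun j => by rw [hshift, hg], ?_, ?_⟩
  · have h := density_mul_norm_sq_ae hf.nonneg hf.integrable (g := g 0) fun j => by
      rw [hshift, (orthonormal_iff_ite.1 hon)]
      simp only [eq_comm]
    filter_upwards [h] with t ht hft
    simp [hft] at ht
  · have h := transfer_eq_boundary_mul_ae (n := n) (μ := μ) hMA.summable (g := g 0) (by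
      refine (hlim 0).congr fun K => Finset.sum_congr rfl fun k _ => ?_
      rw [hshift, zero_sub])
    filter_upwards [h, spectralMeasure_absolutelyContinuous.ae_le
      (transfer_ne_zero_ae n (s := μ) (by exact_mod_cast hμ.ne'))] with t h1 h2
    -- The transfer function is nonzero here, hence so is its factor `boundary φ t`, and division is
    -- legitimate.
    rw [h1] at h2 ⊢
    rw [mul_comm (boundary φ t : ℂ), mul_inv_cancel_right₀ (left_ne_zero_of_mul h2)]

end Transfer

/-! ### Parseval's identity for trigonometric polynomials -/

theorem integral_norm_sq_trigPoly {N : ℕ} (u : Fin (N + 1) → ℂ) :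
    1 / (2 * Real.pi) * ∫ t in (-Real.pi)..Real.pi, ‖trigPoly u t‖ ^ 2 = ∑ k, ‖u k‖ ^ 2 := by
  have h1 : ∀ t : ℝ, ((‖trigPoly u t‖ ^ 2 : ℝ) : ℂ) = ∑ k : Fin (N + 1), ∑ l : Fin (N + 1),
      Complex.exp (Complex.I * t * ((k : ℕ) - (l : ℕ) : ℤ)) * (u k * starRingEnd ℂ (u l)) := by
    intro t
    rw [Complex.ofReal_pow, ← Complex.mul_conj', trigPoly, map_sum, Finset.sum_mul_sum]
    refine Finset.sum_congr rfl fun k _ => Finset.sum_congr rfl fun l _ => ?_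
    have h2 := conj_exp_I_mul t (l : ℕ)
    have h3 := exp_I_mul_add t (k : ℕ) (-(l : ℕ))
    rw [Int.cast_natCast] at h2 h3
    rw [map_mul, h2, sub_eq_add_neg, h3]
    ring
  have hexp : ∀ m : ℤ, Integrable (fun t : ℝ => Complex.exp (Complex.I * t * m)) circleVolume :=
    fun m => Integrable.of_bound (Measurable.aestronglyMeasurable (by fun_prop)) 1
      (Eventually.of_forall fun t => (norm_exp_I_mul t m).le)
  have h2 : ((∫ t in (-Real.pi)..Real.pi, ‖trigPoly u t‖ ^ 2 : ℝ) : ℂ) =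
      ((2 * Real.pi * ∑ k, ‖u k‖ ^ 2 : ℝ) : ℂ) := by
    rw [← intervalIntegral.integral_ofReal, ← integral_circleVolume]
    simp_rw [h1]
    rw [integral_finsetSum _ fun k _ => integrable_finsetSum _ fun l _ => (hexp _).mul_const _]
    simp_rw [integral_finsetSum _ fun l _ => (hexp _).mul_const _, integral_mul_const,
      integral_exp_circleVolume]
    push_cast
    rw [Finset.mul_sum]
    refine Finset.sum_congr rfl fun k _ => ?_
    rw [Finset.sum_eq_single k]
    · rw [if_pos (sub_self _), Complex.mul_conj']
    · intro l _ hl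
      rw [if_neg, zero_mul]
      intro h
      exact hl (Fin.ext (by omega))
    · simp
  have h3 : (∫ t in (-Real.pi)..Real.pi, ‖trigPoly u t‖ ^ 2) = 2 * Real.pi * ∑ k, ‖u k‖ ^ 2 := by
    exact_mod_cast h2
  rw [h3]
  have := Real.pi_ne_zero
  field_simp

/-! ### Finite combinations of increments -/

/-- The increment `x ↦ x⁽ⁿ⁾(m, s)` as a linear functional of the sequence. -/
def incrFunctional (n : ℕ) (m s : ℤ) : Module.Dual ℂ (ℤ → ℂ) where
  toFun x := nthIncr n x m s
  map_add' x y := by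
    simp [nthIncr, mul_add, Finset.sum_add_distrib]
  map_smul' c x := by
    simp only [nthIncr, Pi.smul_apply, smul_eq_mul, RingHom.id_apply, Finset.mul_sum]
    exact Finset.sum_congr rfl fun l _ => by ring

theorem incrFunctional_apply (n : ℕ) (m s : ℤ) (x : ℤ → ℂ) :
    incrFunctional n m s x = nthIncr n x m s := rfl

/-- The difference operator `x ↦ (m ↦ x(m) - x(m - s))`. -/
def diffMap (s : ℤ) : (ℤ → ℂ) →ₗ[ℂ] (ℤ → ℂ) where
  toFun x := fun m => x m - x (m - s)
  map_add' x y := by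
    ext m
    simp only [Pi.add_apply]
    ring
  map_smul' c x := by
    ext m
    simp only [Pi.smul_apply, smul_eq_mul, RingHom.id_apply]
    ring

theorem nthIncr_succ (n : ℕ) (x : ℤ → ℂ) (m s : ℤ) :
    nthIncr (n + 1) x m s = nthIncr n x m s - nthIncr n x (m - s) s := by
  -- The added term `l = n + 1` has binomial coefficient `0`; it makes both sums match for Pascal's
  -- rule.
  have h1 : nthIncr n x m s =
      ∑ l ∈ Finset.range (n + 2), (-1 : ℂ) ^ l * (n.choose l : ℂ) * x (m - l * s) := by
    rw [Finset.sum_range_succ, nthIncr]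
    simp
  have h2 : nthIncr n x (m - s) s =
      ∑ l ∈ Finset.range (n + 1), (-1 : ℂ) ^ l * (n.choose l : ℂ) * x (m - (l + 1 : ℕ) * s) := by
    rw [nthIncr]
    refine Finset.sum_congr rfl fun l _ => ?_
    congr 2
    push_cast
    ring
  rw [h1, h2, Finset.sum_range_succ', nthIncr, Finset.sum_range_succ', add_sub_right_comm,
    ← Finset.sum_sub_distrib]
  congr 1
  · refine Finset.sum_congr rfl fun l _ => ?_
    rw [Nat.choose_succ_succ]
    push_cast
    ring
  · simp

theorem nthIncr_diffMap (n : ℕ) (x : ℤ → ℂ) (m s r : ℤ) :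
    nthIncr n (diffMap r x) m s = nthIncr n x m s - nthIncr n x (m - r) s := by
  simp only [nthIncr, ← Finset.sum_sub_distrib]
  refine Finset.sum_congr rfl fun l _ => ?_
  change _ * (x (m - l * s) - x (m - l * s - r)) = _
  rw [show m - l * s - r = m - r - l * s by ring]
  ring

/-- In Laurent polynomials `(1 - z)^n` divides `(1 - z^s)^n`. The induction on `n` applies one more
difference of step `s`, which telescopes into differences of step `1`, for either sign of `s`. -/
theorem incrFunctional_mem_span (n : ℕ) (m s : ℤ) :
    incrFunctional n m s ∈ Submodule.span ℂ (Set.range fun k => incrFunctional n k 1) := by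
  induction n generalizing m with
  | zero =>
    refine Submodule.subset_span ⟨m, ?_⟩
    ext x
    simp [incrFunctional, nthIncr]
  | succ n ih =>
    set W := Submodule.span ℂ (Set.range fun k => incrFunctional (n + 1) k 1)
    have hstep : ∀ k, incrFunctional n k 1 - incrFunctional n (k - 1) 1 ∈ W := fun k =>
      Submodule.subset_span ⟨k, by
        ext x
        exact nthIncr_succ n x k 1⟩
    have htel : ∀ r k : ℤ, incrFunctional n k 1 - incrFunctional n (k - r) 1 ∈ W := by
      intro r
      induction r using Int.induction_on with
      | zero => intro k; simp
      | succ i hi =>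
        intro k
        have := W.add_mem (hi k) (hstep (k - i))
        rwa [sub_add_sub_cancel, sub_sub] at this
      | pred i hi =>
        intro k
        have := W.sub_mem (hi k) (hstep (k - (-i - 1)))
        rw [show k - (-(i : ℤ) - 1) - 1 = k - -i by ring] at this
        convert this using 1
        abel
    have h1 : incrFunctional (n + 1) m s = (diffMap s).dualMap (incrFunctional n m s) := by
      ext x
      rw [LinearMap.dualMap_apply, incrFunctional_apply, incrFunctional_apply, nthIncr_diffMap,
        nthIncr_succ]
    rw [h1]
    have h2 := Submodule.mem_map_of_mem (f := (diffMap s).dualMap) (ih m)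
    rw [Submodule.map_span] at h2
    refine Submodule.span_le.2 ?_ h2
    rintro _ ⟨_, ⟨k, rfl⟩, rfl⟩
    have h3 : (diffMap s).dualMap (incrFunctional n k 1) =
        incrFunctional n k 1 - incrFunctional n (k - s) 1 := by
      ext x
      exact nthIncr_diffMap n x k 1 s
    simp only [h3]
    exact htel s k

theorem nthIncr_single_self (n : ℕ) (j : ℤ) : nthIncr n (Pi.single j 1) j 1 = 1 := by
  rw [nthIncr, Finset.sum_eq_single_of_mem 0 (by simp)]
  · simp
  · intro l _ hl
    rw [Pi.single_eq_of_ne (by omega), mul_zero]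

theorem nthIncr_single_of_lt (n : ℕ) {j k : ℤ} (h : k < j) :
    nthIncr n (Pi.single j 1) k 1 = 0 :=
  Finset.sum_eq_zero fun l _ => by rw [Pi.single_eq_of_ne (by omega), mul_zero]

/-- A finite combination of increments that involves only the values at times `≤ -1` is a finite
combination of the increments `x⁽ⁿ⁾(k, 1)`, `k ≤ -1`. -/
theorem exists_combination_past_increments {n : ℕ} {c : ℤ →₀ ℂ} (hc : c ∈ observedCoeffs)
    {g : ℤ × ℤ →₀ ℂ} (h : ∀ x : ℤ → ℂ, (c.sum fun k z => z * x k) =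
      g.sum fun p z => z * nthIncr n x p.1 p.2) :
    ∃ q : ℤ →₀ ℂ, q ∈ observedCoeffs ∧ ∀ x : ℤ → ℂ,
      (c.sum fun k z => z * x k) = q.sum fun k z => z * nthIncr n x k 1 := by
  have h1 : (∑ p ∈ g.support, g p • incrFunctional n p.1 p.2) ∈
      Submodule.span ℂ (Set.range fun k => incrFunctional n k 1) :=
    Submodule.sum_mem _ fun p _ => Submodule.smul_mem _ _ (incrFunctional_mem_span n p.1 p.2)
  obtain ⟨q, hq⟩ := Finsupp.mem_span_range_iff_exists_finsupp.1 h1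
  have h2 : ∀ x : ℤ → ℂ, (c.sum fun k z => z * x k) = q.sum fun k z => z * nthIncr n x k 1 := by
    intro x
    rw [h x]
    have := LinearMap.congr_fun hq x
    simp only [Finsupp.sum, LinearMap.sum_apply, LinearMap.smul_apply, smul_eq_mul,
      incrFunctional_apply] at this ⊢
    exact this.symm
  refine ⟨q, ?_, h2⟩
  -- Let `j` be the largest index `> -1` in the support of `q`. On the unit sequence at `j` the
  -- right side is `q j`, while the left side, which sees only times `≤ -1`, is `0`.
  by_contra hq'
  have hne : (q.support.filter fun k => ¬ k ≤ -1).Nonempty := by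
    simp only [observedCoeffs, Set.mem_ofPred_eq, not_forall] at hq'
    obtain ⟨k, hk, hk'⟩ := hq'
    exact ⟨k, Finset.mem_filter.2 ⟨hk, hk'⟩⟩
  obtain ⟨j, hj, hmax⟩ := Finset.exists_max_image _ id hne
  simp only [Finset.mem_filter, id] at hj hmax
  have h3 := h2 (Pi.single j 1)
  have h4 : (q.sum fun k z => z * nthIncr n (Pi.single j 1) k 1) = q j := by
    rw [Finsupp.sum, Finset.sum_eq_single_of_mem j hj.1]
    · rw [nthIncr_single_self, mul_one]
    · intro k hk hkj
      have : k < j := by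
        by_contra hlt
        have := hmax k ⟨hk, by omega⟩
        omega
      rw [nthIncr_single_of_lt n this, mul_zero]
  have h5 : (c.sum fun k z => z * (Pi.single j 1 : ℤ → ℂ) k) = 0 := by
    refine Finset.sum_eq_zero fun k hk => ?_
    have := hc k hk
    simp only
    rw [Pi.single_eq_of_ne (by omega), mul_zero]
  rw [h4, h5] at h3
  exact Finsupp.mem_support_iff.1 hj.1 h3.symm

/-! ### The representation of the functional by increments -/

theorem one_sub_X_pow_mul_mk {μ : ℕ} (hμ : 0 < μ) :
    (1 - (PowerSeries.X : PowerSeries ℂ) ^ μ) *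
      (PowerSeries.mk fun j => if μ ∣ j then (1 : ℂ) else 0) = 1 := by
  ext k
  rw [sub_mul, one_mul, map_sub, PowerSeries.coeff_X_pow_mul', PowerSeries.coeff_mk,
    PowerSeries.coeff_one]
  rcases Nat.eq_zero_or_pos k with rfl | hk
  · simp [hμ.ne']
  · rw [if_neg hk.ne']
    by_cases hle : μ ≤ k
    · simp only [hle, if_true, PowerSeries.coeff_mk]
      rw [sub_eq_zero]
      congr 1
      rw [eq_iff_iff]
      exact (Nat.dvd_sub_iff_left hle dvd_rfl).symm
    · have : ¬ μ ∣ k := fun h => hle (Nat.le_of_dvd hk h)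
      simp [hle, this]

/-- Coefficient of `X^k` in `(1 - X^μ)^n (∑ X^{μj})^n = 1`. -/
theorem sum_choose_mul_dCoeff (n : ℕ) {μ : ℕ} (hμ : 0 < μ) (k : ℕ) :
    ∑ l ∈ Finset.range (n + 1), (-1 : ℂ) ^ l * (n.choose l : ℂ) *
      (if l * μ ≤ k then dCoeff n μ (k - l * μ) else 0) = if k = 0 then 1 else 0 := by
  have h := congrArg (fun p : PowerSeries ℂ => PowerSeries.coeff k (p ^ n))
    (one_sub_X_pow_mul_mk hμ)
  simp only [one_pow, mul_pow, PowerSeries.coeff_one] at h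
  rw [← h, sub_eq_add_neg, add_comm 1 (-_), add_pow, Finset.sum_mul, map_sum]
  refine Finset.sum_congr rfl fun l _ => ?_
  have h1 : (-(PowerSeries.X : PowerSeries ℂ) ^ μ) ^ l * 1 ^ (n - l) * (n.choose l : PowerSeries ℂ) *
      (PowerSeries.mk fun j => if μ ∣ j then (1 : ℂ) else 0) ^ n =
      ((-1 : ℂ) ^ l * (n.choose l : ℂ)) • (PowerSeries.X ^ (l * μ) *
        (PowerSeries.mk fun j => if μ ∣ j then (1 : ℂ) else 0) ^ n) := by
    rw [neg_pow, ← pow_mul, mul_comm μ l, one_pow, mul_one, PowerSeries.smul_eq_C_mul]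
    simp only [map_mul, map_pow, map_neg, map_one, map_natCast]
    ring
  rw [h1, PowerSeries.coeff_smul, PowerSeries.coeff_X_pow_mul', smul_eq_mul]
  rfl

theorem sum_Icc_natCast_add (a : ℕ → ℂ) (d : ℕ → ℂ) (N j p : ℕ) :
    ∑ m ∈ Finset.Icc (j + p) N, a m * d (m - (j + p)) =
      ∑ m ∈ Finset.Icc j N, a m * (if p ≤ m - j then d (m - j - p) else 0) := by
  refine Finset.sum_subset_zero_on_sdiff (Finset.Icc_subset_Icc_left (Nat.le_add_right _ _))
    (fun m hm => ?_) (fun m hm => ?_)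
  · simp only [Finset.mem_sdiff, Finset.mem_Icc] at hm
    rw [if_neg (by omega), mul_zero]
  · simp only [Finset.mem_Icc] at hm
    rw [if_pos (by omega), Nat.sub_sub]

/-- The `n`th difference undoes the summation by `d_μ`: after exchanging the sums, only `m = j`
survives. -/
theorem sum_choose_mul_bCoeff (n : ℕ) {μ : ℕ} (hμ : 0 < μ) {N : ℕ} (a : ℕ → ℂ) {j : ℕ}
    (hj : j ≤ N) :
    ∑ l ∈ Finset.range (n + 1), (-1 : ℂ) ^ l * (n.choose l : ℂ) * bCoeff n μ N a (j + l * μ) =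
      a j := by
  simp only [bCoeff, sum_Icc_natCast_add, Finset.mul_sum]
  rw [Finset.sum_comm, Finset.sum_eq_single_of_mem j (by simp [hj])]
  · have := sum_choose_mul_dCoeff n hμ 0
    rw [if_pos rfl] at this
    calc _ = a j * ∑ l ∈ Finset.range (n + 1), (-1 : ℂ) ^ l * (n.choose l : ℂ) *
          (if l * μ ≤ 0 then dCoeff n μ (0 - l * μ) else 0) := by
          rw [Finset.mul_sum]
          refine Finset.sum_congr rfl fun l _ => ?_
          rw [Nat.sub_self]
          exact mul_left_comm _ _ _
      _ = a j := by rw [this, mul_one]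
  · intro m hm hmj
    simp only [Finset.mem_Icc] at hm
    have := sum_choose_mul_dCoeff n hμ (m - j)
    rw [if_neg (by omega)] at this
    calc _ = a m * ∑ l ∈ Finset.range (n + 1), (-1 : ℂ) ^ l * (n.choose l : ℂ) *
          (if l * μ ≤ m - j then dCoeff n μ (m - j - l * μ) else 0) := by
          rw [Finset.mul_sum]
          exact Finset.sum_congr rfl fun l _ => mul_left_comm _ _ _
      _ = 0 := by rw [this, mul_zero]

theorem bCoeff_of_lt (n μ : ℕ) {N : ℕ} (a : ℕ → ℂ) {k : ℕ} (h : N < k) : bCoeff n μ N a k = 0 := by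
  rw [bCoeff, Finset.Icc_eq_empty (by omega), Finset.sum_empty]

/-- The rounded bounds encode `0 ≤ k + l μ ≤ N`; the upper one may be dropped because `b` vanishes
beyond `N`. -/
theorem vCoeff_eq (n : ℕ) {μ : ℕ} (hμ : 0 < μ) (N : ℕ) (a : ℕ → ℂ) {k : ℤ} (hk : k ≤ -1) :
    vCoeff n μ N a k = ∑ l ∈ Finset.range (n + 1), (-1 : ℂ) ^ l * (n.choose l : ℂ) *
      (if 0 ≤ k + l * μ then bCoeff n μ N a (k + l * μ).toNat else 0) := by
  have hμ' : (0 : ℚ) < μ := by exact_mod_cast hμ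
  have hmem : ∀ l : ℕ, l ∈ Finset.Icc ⌈-(k : ℚ) / μ⌉₊ (min ⌊((N : ℚ) - k) / μ⌋₊ n) ↔
      0 ≤ k + l * μ ∧ k + l * μ ≤ N ∧ l ≤ n := by
    intro l
    have hnn : 0 ≤ ((N : ℚ) - k) / μ := by
      have : (k : ℚ) ≤ -1 := by exact_mod_cast hk
      have : (0 : ℚ) ≤ N := Nat.cast_nonneg N
      exact div_nonneg (by linarith) hμ'.le
    rw [Finset.mem_Icc, le_min_iff, Nat.ceil_le, Nat.le_floor_iff hnn, div_le_iff₀ hμ',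
      le_div_iff₀ hμ']
    have e1 : (-(k : ℚ) ≤ l * μ) ↔ 0 ≤ k + l * μ := by
      rw [neg_le_iff_add_nonneg']
      exact_mod_cast Iff.rfl
    have e2 : ((l : ℚ) * μ ≤ N - k) ↔ k + l * μ ≤ N := by
      rw [le_sub_iff_add_le']
      exact_mod_cast Iff.rfl
    rw [e1, e2]
  rw [vCoeff]
  refine Finset.sum_subset_zero_on_sdiff (fun l hl => ?_) (fun l hl => ?_) (fun l hl => ?_)
  · have := (hmem l).1 hl
    exact Finset.mem_range.2 (by omega)
  · rw [Finset.mem_sdiff, hmem, Finset.mem_range] at hl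
    split_ifs with h0
    · rw [bCoeff_of_lt _ _ _ (by omega), mul_zero]
    · rw [mul_zero]
  · rw [if_pos ((hmem l).1 hl).1, add_comm]

/-- The functional is a combination of the increments with step `μ`, minus a combination of the
observed values. -/
theorem sum_eq_increments_sub (n : ℕ) {μ : ℕ} (hμ : 0 < μ) (N : ℕ) (a : ℕ → ℂ) (x : ℤ → ℂ) :
    ∑ k ∈ Finset.range (N + 1), a k * x k =
      (∑ k ∈ Finset.range (N + 1), bCoeff n μ N a k * nthIncr n x k μ) -
        ∑ k ∈ Finset.Icc (-((μ : ℤ) * n)) (-1), vCoeff n μ N a k * x k := by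
  -- Extending `b` by zero to all integers lets every shift by `l μ` be summed over the same range
  -- of times.
  let β : ℤ → ℂ := fun j => if 0 ≤ j then bCoeff n μ N a j.toNat else 0
  have h1 : ∀ l ∈ Finset.range (n + 1),
      ∑ k ∈ Finset.range (N + 1), bCoeff n μ N a k * x (k - l * μ) =
        ∑ j ∈ Finset.Icc (-((μ : ℤ) * n)) N, β (j + l * μ) * x j := by
    intro l hl
    have hl' : (l : ℤ) * μ ≤ μ * n := by
      rw [mul_comm]
      have : (l : ℤ) ≤ n := by have := Finset.mem_range.1 hl; omega
      exact mul_le_mul_of_nonneg_left this (by positivity)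
    have hl0 : (0 : ℤ) ≤ l * μ := by positivity
    refine Finset.sum_of_injOn (fun k : ℕ => (k : ℤ) - l * μ) (fun i _ j _ h => by simpa using h)
      (fun k hk => ?_) (fun j _ hj => ?_) (fun k _ => ?_)
    · simp only [Finset.coe_range, Set.mem_Iio] at hk
      simp only [Finset.coe_Icc, Set.mem_Icc]
      constructor <;> omega
    · have : β (j + l * μ) = 0 := by
        simp only [β]
        split_ifs with h0
        · refine bCoeff_of_lt _ _ _ ?_
          by_contra hlt
          exact hj ⟨(j + l * μ).toNat, by simp; omega, by simp [h0]⟩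
        · rfl
      rw [this, zero_mul]
    · simp only [β, sub_add_cancel]
      rw [if_pos (by positivity), Int.toNat_natCast]
  have h2 : ∑ k ∈ Finset.range (N + 1), bCoeff n μ N a k * nthIncr n x k μ =
      ∑ j ∈ Finset.Icc (-((μ : ℤ) * n)) N,
        (∑ l ∈ Finset.range (n + 1), (-1 : ℂ) ^ l * (n.choose l : ℂ) * β (j + l * μ)) * x j := by
    simp only [nthIncr, Finset.mul_sum, Finset.sum_mul]
    rw [Finset.sum_comm, Finset.sum_comm (s := Finset.Icc _ _)]
    refine Finset.sum_congr rfl fun l hl => ?_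
    simp only [mul_assoc ((-1 : ℂ) ^ l * (n.choose l : ℂ))]
    rw [← Finset.mul_sum, ← h1 l hl, Finset.mul_sum]
    exact Finset.sum_congr rfl fun k _ => by ring
  have h3 : Finset.Icc (-((μ : ℤ) * n)) (N : ℤ) = Finset.Icc (-((μ : ℤ) * n)) (-1) ∪
      (Finset.range (N + 1)).map Nat.castEmbedding := by
    have h0 : (0 : ℤ) ≤ μ * n := by positivity
    ext j
    simp only [Finset.mem_Icc, Finset.mem_union, Finset.mem_map, Finset.mem_range,
      Nat.castEmbedding_apply]
    constructor
    · intro h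
      rcases lt_or_ge j 0 with hj | hj
      · left; omega
      · right; exact ⟨j.toNat, by omega, by omega⟩
    · rintro (h | ⟨k, hk, rfl⟩)
      · constructor <;> omega
      · constructor <;> omega
  have h4 : Disjoint (Finset.Icc (-((μ : ℤ) * n)) (-1))
      ((Finset.range (N + 1)).map (Nat.castEmbedding (R := ℤ))) := by
    rw [Finset.disjoint_left]
    intro j hj hj'
    simp only [Finset.mem_Icc, Finset.mem_map, Nat.castEmbedding_apply] at hj hj'
    obtain ⟨k, _, rfl⟩ := hj'
    omega
  -- At negative times the coefficient is `v(j)` and cancels; at times `0, …, N` the inversion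
  -- formula gives `a(j)`.
  rw [h2, h3, Finset.sum_union h4, Finset.sum_map, add_sub_right_comm, ← Finset.sum_sub_distrib]
  rw [Finset.sum_eq_zero (s := Finset.Icc _ _), zero_add]
  · refine Finset.sum_congr rfl fun j hj => ?_
    rw [← sum_choose_mul_bCoeff n hμ a (Nat.lt_succ_iff.1 (Finset.mem_range.1 hj))]
    simp only [Nat.castEmbedding_apply, β]
    rfl
  · intro j hj
    rw [vCoeff_eq n hμ N a (Finset.mem_Icc.1 hj).2, sub_self]

/-! ### The vectors in the formulas -/

theorem mulVec_matD (n μ N : ℕ) (a : ℕ → ℂ) (k : Fin (N + 1)) :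
    (matD n μ N).mulVec (vecN N a) k = bCoeff n μ N a k := by
  rw [Matrix.mulVec, dotProduct, bCoeff]
  simp only [matD, Matrix.of_apply, vecN, Fin.le_iff_val_le_val]
  rw [Fin.sum_univ_eq_sum_range
    (fun i => (if (k : ℕ) ≤ i then dCoeff n μ (i - (k : ℕ)) else 0) * a i) (N + 1)]
  symm
  refine Finset.sum_subset_zero_on_sdiff (fun m hm => ?_) (fun m hm => ?_) (fun m hm => ?_)
  · rw [Finset.mem_Icc] at hm
    exact Finset.mem_range.2 (by omega)
  · rw [Finset.mem_sdiff, Finset.mem_Icc, Finset.mem_range] at hm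
    rw [if_neg (by omega), zero_mul]
  · rw [Finset.mem_Icc] at hm
    rw [if_pos hm.1, mul_comm]

/-- Substitute `m = k + p`: multiplying by `D_N^μ` turns the Hankel matrix of `a` into that of `b`.
-/
theorem matD_mul_matA (n μ N : ℕ) (a : ℕ → ℂ) (j p : Fin (N + 1)) :
    (matD n μ N * matA N a) j p = bCoeff n μ N a (j + p) := by
  rw [Matrix.mul_apply, bCoeff]
  simp only [matD, matA, Matrix.of_apply, Fin.le_iff_val_le_val]
  rw [Fin.sum_univ_eq_sum_range
    (fun k => (if (j : ℕ) ≤ k then dCoeff n μ (k - (j : ℕ)) else 0) *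
      (if k + (p : ℕ) ≤ N then a (k + (p : ℕ)) else 0)) (N + 1)]
  symm
  refine Finset.sum_of_injOn (fun m => m - (p : ℕ)) (fun m hm l hl h => ?_) (fun m hm => ?_)
    (fun k _ hk => ?_) (fun m hm => ?_)
  · simp only [Finset.coe_Icc, Set.mem_Icc] at hm hl h
    omega
  · simp only [Finset.coe_Icc, Set.mem_Icc] at hm
    simp only [Finset.coe_range, Set.mem_Iio]
    omega
  · by_cases h1 : (j : ℕ) ≤ k
    · by_cases h2 : k + (p : ℕ) ≤ N
      · exact absurd ⟨k + p, by simp; omega, by simp⟩ hk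
      · rw [if_neg h2, mul_zero]
    · rw [if_neg h1, zero_mul]
  · rw [Finset.mem_Icc] at hm
    rw [if_pos (by omega), Nat.sub_add_cancel (by omega), if_pos hm.2, mul_comm,
      Nat.sub_sub, add_comm (p : ℕ)]

theorem errorVec_apply (n μ N : ℕ) (a φ : ℕ → ℂ) (j : Fin (N + 1)) :
    errorVec n μ N a φ j = ∑ p ∈ Finset.range (N + 1), bCoeff n μ N a (j + p) * φ p := by
  rw [errorVec, Matrix.mulVec, dotProduct]
  simp only [matD_mul_matA, vecN]
  rw [Fin.sum_univ_eq_sum_range (fun p => bCoeff n μ N a (j + p) * φ p) (N + 1)]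

/-- The part of `∑ b(k) ∑ φ(m) e(k - m)` that involves the terms `e(j)`, `j ≥ 0`. -/
theorem sum_errorVec_smul {E : Type*} [AddCommGroup E] [Module ℂ E] (n μ N : ℕ) (a φ : ℕ → ℂ)
    (e : ℤ → E) :
    ∑ j, errorVec n μ N a φ j • e ((j : ℕ) : ℤ) =
      ∑ k ∈ Finset.range (N + 1), bCoeff n μ N a k •
        ∑ m ∈ Finset.range (k + 1), φ m • e ((k : ℤ) - m) := by
  simp only [errorVec_apply]
  rw [Fin.sum_univ_eq_sum_range (fun j => (∑ p ∈ Finset.range (N + 1),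
    bCoeff n μ N a (j + p) * φ p) • e (j : ℤ)) (N + 1)]
  simp only [Finset.sum_smul, Finset.smul_sum, smul_smul]
  rw [Finset.sum_sigma', Finset.sum_sigma']
  symm
  -- The substitution is `j = k - m`, `p = m`; pairs with `j + p > N` are not hit, but there `b` is
  -- zero.
  refine Finset.sum_of_injOn (fun q => ⟨q.1 - q.2, q.2⟩) (fun q hq r hr h => ?_) (fun q hq => ?_)
    (fun q hq h => ?_) (fun q hq => ?_)
  · obtain ⟨q1, q2⟩ := q
    obtain ⟨r1, r2⟩ := r
    simp only [Finset.coe_sigma, Set.mem_sigma_iff, Finset.coe_range, Set.mem_Iio] at hq hr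
    simp only [Sigma.mk.injEq, heq_eq_eq] at h ⊢
    omega
  · simp only [Finset.coe_sigma, Set.mem_sigma_iff, Finset.coe_range, Set.mem_Iio] at hq ⊢
    omega
  · obtain ⟨j, p⟩ := q
    simp only [Finset.mem_sigma, Finset.mem_range] at hq
    have : N < j + p := by
      by_contra hlt
      refine h ⟨⟨j + p, p⟩, ?_, by simp⟩
      simp only [Finset.coe_sigma, Set.mem_sigma_iff, Finset.coe_range, Set.mem_Iio]
      omega
    rw [bCoeff_of_lt _ _ _ this, zero_mul, zero_smul]
  · simp only [Finset.mem_sigma, Finset.mem_range] at hq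
    simp only
    rw [Nat.sub_add_cancel (by omega), Nat.cast_sub (by omega)]

/-! ### Optimal estimates -/

section Estimates

open scoped InnerProductSpace

variable {Ω : Type*} [MeasurableSpace Ω] {P : Measure Ω} {ξ : ℤ → Ω → ℂ}

theorem lintegral_enorm_sq_eq (X : Lp ℂ 2 P) :
    ∫⁻ ω, ‖X ω‖ₑ ^ 2 ∂P = ENNReal.ofReal (‖X‖ ^ 2) := by
  have h1 : eLpNorm X 2 P = (∫⁻ ω, ‖X ω‖ₑ ^ 2 ∂P) ^ (1 / 2 : ℝ) := by
    rw [eLpNorm_eq_lintegral_rpow_enorm_toReal two_ne_zero ENNReal.ofNat_ne_top]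
    simp
  have h2 : eLpNorm X 2 P = ENNReal.ofReal ‖X‖ := by
    rw [Lp.norm_def, ENNReal.ofReal_toReal (Lp.eLpNorm_ne_top X)]
  rw [ENNReal.ofReal_pow (norm_nonneg _), ← h2, h1, ← ENNReal.rpow_natCast, ← ENNReal.rpow_mul]
  simp

/-- The linear estimates form a translate of a closed subspace as soon as the finite linear
combinations form a translate of a subspace. -/
theorem mem_linearEstimates_iff {S : Set (ℤ →₀ ℂ)} {V : Ω → ℂ} (hV : AEMeasurable V P)
    {W : Submodule ℂ (Lp ℂ 2 P)}
    (h1 : ∀ c ∈ S, ∃ w ∈ W, (fun ω => c.sum fun k z => z * ξ k ω) =ᵐ[P] fun ω => -V ω + w ω)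
    (h2 : ∀ w ∈ W, ∃ c ∈ S, (fun ω => c.sum fun k z => z * ξ k ω) =ᵐ[P] fun ω => -V ω + w ω)
    (η : Ω → ℂ) :
    η ∈ linearEstimates P ξ S ↔
      ∃ w ∈ W.topologicalClosure, η =ᵐ[P] fun ω => -V ω + w ω := by
  constructor
  · rintro ⟨hη, h⟩
    have hm : AEStronglyMeasurable (fun ω => η ω + V ω) P := (hη.add hV).aestronglyMeasurable
    have happ : ∀ δ : ℝ≥0∞, 0 < δ → ∃ w ∈ W, eLpNorm (fun ω => (η ω + V ω) - w ω) 2 P < δ := by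
      intro δ hδ
      obtain ⟨c, hc, hlt⟩ := h δ hδ
      obtain ⟨w, hw, hcw⟩ := h1 c hc
      refine ⟨w, hw, lt_of_eq_of_lt (eLpNorm_congr_ae ?_) hlt⟩
      filter_upwards [hcw] with ω hω
      rw [hω]
      ring
    -- Neither `η` nor `V` need be square integrable, but their sum is within finite distance of an
    -- element of `W`.
    have hmem : MemLp (fun ω => η ω + V ω) 2 P := by
      obtain ⟨w, -, hlt⟩ := happ 1 one_pos
      have h3 : MemLp (fun ω => (η ω + V ω) - w ω) 2 P :=
        ⟨hm.sub (Lp.aestronglyMeasurable w), hlt.trans ENNReal.one_lt_top⟩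
      refine (h3.add (Lp.memLp w)).ae_eq (Eventually.of_forall fun ω => ?_)
      simp
    refine ⟨hmem.toLp _, ?_, ?_⟩
    · rw [← SetLike.mem_coe, Submodule.topologicalClosure_coe, EMetric.mem_closure_iff]
      intro δ hδ
      obtain ⟨w, hw, hlt⟩ := happ δ hδ
      refine ⟨w, hw, lt_of_eq_of_lt ?_ hlt⟩
      rw [Lp.edist_def]
      refine eLpNorm_congr_ae ?_
      filter_upwards [hmem.coeFn_toLp] with ω hω
      rw [Pi.sub_apply, hω]
    · filter_upwards [hmem.coeFn_toLp] with ω hω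
      rw [hω]
      ring
  · rintro ⟨w, hw, hη⟩
    refine ⟨(hV.neg.add (Lp.aestronglyMeasurable w).aemeasurable).congr hη.symm, fun δ hδ => ?_⟩
    rw [← SetLike.mem_coe, Submodule.topologicalClosure_coe, EMetric.mem_closure_iff] at hw
    obtain ⟨w', hw', hlt⟩ := hw δ hδ
    obtain ⟨c, hc, hcw⟩ := h2 w' hw'
    refine ⟨c, hc, lt_of_eq_of_lt ?_ hlt⟩
    rw [Lp.edist_def]
    refine eLpNorm_congr_ae ?_
    filter_upwards [hη, hcw] with ω h3 h4
    rw [h3, h4, Pi.sub_apply]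
    ring

/-- The projection theorem for linear estimates: if `A = -V + B + E` with `B` in the closed
subspace and `E` orthogonal to it, then `-V + B` is the optimal estimate of `A`. -/
theorem isOptimalEstimate_iff {S : Set (ℤ →₀ ℂ)} {V A : Ω → ℂ} {W : Submodule ℂ (Lp ℂ 2 P)}
    (hS : ∀ η, η ∈ linearEstimates P ξ S ↔
      ∃ w ∈ W.topologicalClosure, η =ᵐ[P] fun ω => -V ω + w ω)
    {B E : Lp ℂ 2 P} (hB : B ∈ W.topologicalClosure)
    (hE : ∀ w ∈ W.topologicalClosure, ⟪w, E⟫_ℂ = 0)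
    (hA : A =ᵐ[P] fun ω => -V ω + B ω + E ω) (η : Ω → ℂ) :
    IsOptimalEstimate P ξ S A η ↔ η =ᵐ[P] fun ω => -V ω + B ω := by
  -- Pythagoras in `L²(P)`; `V` cancels in `A - η`, so `A` itself need not be square integrable.
  have hmse : ∀ w ∈ W.topologicalClosure, ∀ η : Ω → ℂ, η =ᵐ[P] (fun ω => -V ω + w ω) →
      mse P A η = ENNReal.ofReal (‖B - w‖ ^ 2 + ‖E‖ ^ 2) := by
    intro w hw η hη
    have h1 : mse P A η = ∫⁻ ω, ‖((B - w) + E : Lp ℂ 2 P) ω‖ₑ ^ 2 ∂P := by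
      refine lintegral_congr_ae ?_
      filter_upwards [hη, hA, Lp.coeFn_add (B - w) E, Lp.coeFn_sub B w] with ω h1 h2 h3 h4
      rw [h1, h2, h3, Pi.add_apply, h4, Pi.sub_apply]
      congr 2
      ring
    rw [h1, lintegral_enorm_sq_eq, sq, sq, sq,
      norm_add_sq_eq_norm_sq_add_norm_sq_of_inner_eq_zero (𝕜 := ℂ) _ _
        (hE _ (Submodule.sub_mem _ hB hw))]
  constructor
  · rintro ⟨h1, h2⟩
    obtain ⟨w, hw, hη⟩ := (hS η).1 h1
    have h3 := h2 (fun ω => -V ω + B ω) ((hS _).2 ⟨B, hB, Eventually.of_forall fun _ => rfl⟩)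
    rw [hmse w hw η hη, hmse B hB _ (Eventually.of_forall fun _ => rfl),
      ENNReal.ofReal_le_ofReal_iff (by positivity), sub_self, norm_zero] at h3
    have h4 : B = w := by
      have : ‖B - w‖ ^ 2 ≤ 0 := by linarith
      have := pow_eq_zero_iff two_ne_zero |>.1 (le_antisymm this (sq_nonneg _))
      exact sub_eq_zero.1 (norm_eq_zero.1 this)
    rw [h4]
    exact hη
  · intro hη
    refine ⟨(hS η).2 ⟨B, hB, hη⟩, fun η' hη' => ?_⟩
    obtain ⟨w, hw, hη'⟩ := (hS η').1 hη'
    rw [hmse B hB η hη, hmse w hw η' hη']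
    refine ENNReal.ofReal_le_ofReal ?_
    rw [sub_self, norm_zero]
    have := sq_nonneg ‖B - w‖
    linarith

theorem mse_eq_of_ae_eq {V A η : Ω → ℂ} {B E : Lp ℂ 2 P}
    (hA : A =ᵐ[P] fun ω => -V ω + B ω + E ω) (hη : η =ᵐ[P] fun ω => -V ω + B ω) :
    mse P A η = ENNReal.ofReal (‖E‖ ^ 2) := by
  rw [← lintegral_enorm_sq_eq]
  refine lintegral_congr_ae ?_
  filter_upwards [hA, hη] with ω h1 h2
  rw [h1, h2, add_sub_cancel_left]

end Estimates

/-! ### The two classes of linear estimates -/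

section Classes

variable {Ω : Type*} [MeasurableSpace Ω] {P : Measure Ω} {n : ℕ} {ξ : ℤ → Ω → ℂ}

/-- `∑_{k = -μn}^{-1} v_{μ,N}(k) ξ(k)`. -/
def observedPart (n μ N : ℕ) (a : ℕ → ℂ) (ξ : ℤ → Ω → ℂ) : Ω → ℂ :=
  fun ω => ∑ k ∈ Finset.Icc (-((μ : ℤ) * n)) (-1), vCoeff n μ N a k * ξ k ω

/-- The coefficients of `∑_{k = -μn}^{-1} v_{μ,N}(k) ξ(k)`. -/
def observedPartCoeffs (n μ N : ℕ) (a : ℕ → ℂ) : ℤ →₀ ℂ :=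
  ∑ k ∈ Finset.Icc (-((μ : ℤ) * n)) (-1), Finsupp.single k (vCoeff n μ N a k)

theorem sum_mul_eq_linearCombination (x : ℤ → ℂ) (c : ℤ →₀ ℂ) :
    (c.sum fun k z => z * x k) = Finsupp.linearCombination ℂ x c := rfl

theorem sum_observedPartCoeffs (n μ N : ℕ) (a : ℕ → ℂ) (x : ℤ → ℂ) :
    ((observedPartCoeffs n μ N a).sum fun k z => z * x k) =
      ∑ k ∈ Finset.Icc (-((μ : ℤ) * n)) (-1), vCoeff n μ N a k * x k := by
  rw [sum_mul_eq_linearCombination, observedPartCoeffs, map_sum]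
  simp

theorem observedCoeffs_eq : observedCoeffs =
    (Finsupp.supported ℂ ℂ (Set.Iic (-1 : ℤ)) : Set (ℤ →₀ ℂ)) := by
  ext c
  rw [SetLike.mem_coe, Finsupp.mem_supported]
  rfl

theorem observedPartCoeffs_mem (n μ N : ℕ) (a : ℕ → ℂ) :
    observedPartCoeffs n μ N a ∈ Finsupp.supported ℂ ℂ (Set.Iic (-1 : ℤ)) :=
  Submodule.sum_mem _ fun _ hk => Finsupp.single_mem_supported _ _ (Finset.mem_Icc.1 hk).2

theorem aemeasurable_observedPart (hmeas : ∀ k, AEMeasurable (ξ k) P) (n μ N : ℕ) (a : ℕ → ℂ) :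
    AEMeasurable (observedPart n μ N a ξ) P :=
  Finset.aemeasurable_fun_sum _ fun k _ => (hmeas k).const_mul _

/-- The span of the increments `ξ⁽ⁿ⁾(m, s)`, `m ≤ -1`, `s > 0`. -/
def pastIncrements (hξ : HasStationaryIncrements P n ξ) : Submodule ℂ (Lp ℂ 2 P) :=
  Submodule.span ℂ ((fun p : ℤ × ℤ => (hξ.memLp p.1 p.2).toLp _) '' {p | p.1 ≤ -1 ∧ 0 < p.2})

theorem sum_nthIncr_eq_linearCombination (n : ℕ) (x : ℤ → ℂ) (g : ℤ × ℤ →₀ ℂ) :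
    (g.sum fun p z => z * nthIncr n x p.1 p.2) =
      Finsupp.linearCombination ℂ (fun p : ℤ × ℤ => nthIncr n x p.1 p.2) g := rfl

/-- The increments at times `k` with `k ≤ -1`, as combinations of observed values. -/
theorem exists_coeffs_nthIncr (n : ℕ) {m s : ℤ} (hm : m ≤ -1) (hs : 0 < s) :
    ∃ c ∈ Finsupp.supported ℂ ℂ (Set.Iic (-1 : ℤ)), ∀ x : ℤ → ℂ,
      (c.sum fun k z => z * x k) = nthIncr n x m s := by
  refine ⟨∑ l ∈ Finset.range (n + 1),
    Finsupp.single (m - l * s) ((-1 : ℂ) ^ l * (n.choose l : ℂ)),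
    Submodule.sum_mem _ fun l _ => Finsupp.single_mem_supported _ _ ?_, fun x => ?_⟩
  · have : (0 : ℤ) ≤ l * s := by positivity
    rw [Set.mem_Iic]
    omega
  · rw [sum_mul_eq_linearCombination, map_sum, nthIncr]
    simp only [Finsupp.linearCombination_single, smul_eq_mul]

/-- Increments of the process from increments of sequences. -/
theorem exists_coeffs_of_mem_pastIncrements (hξ : HasStationaryIncrements P n ξ) {w : Lp ℂ 2 P}
    (hw : w ∈ pastIncrements hξ) :
    ∃ c ∈ Finsupp.supported ℂ ℂ (Set.Iic (-1 : ℤ)), ∃ g : ℤ × ℤ →₀ ℂ,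
      (∀ x : ℤ → ℂ, (c.sum fun k z => z * x k) = g.sum fun p z => z * nthIncr n x p.1 p.2) ∧
        w =ᵐ[P] fun ω => c.sum fun k z => z * ξ k ω := by
  simp only [sum_mul_eq_linearCombination, sum_nthIncr_eq_linearCombination]
  induction hw using Submodule.span_induction with
  | mem w hw =>
    obtain ⟨p, ⟨h1, h2⟩, rfl⟩ := hw
    obtain ⟨c, hc, h⟩ := exists_coeffs_nthIncr n h1 h2
    refine ⟨c, hc, Finsupp.single p 1, fun x => ?_, ?_⟩
    · rw [← sum_mul_eq_linearCombination, h]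
      simp
    · filter_upwards [(hξ.memLp p.1 p.2).coeFn_toLp] with ω hω
      rw [hω, ← sum_mul_eq_linearCombination, h]
      rfl
  | zero =>
    refine ⟨0, Submodule.zero_mem _, 0, fun x => by simp, ?_⟩
    filter_upwards [Lp.coeFn_zero ℂ 2 P] with ω hω
    rw [hω, map_zero, Pi.zero_apply]
  | add v w _ _ hv hw =>
    obtain ⟨c, hc, g, h1, h2⟩ := hv
    obtain ⟨c', hc', g', h1', h2'⟩ := hw
    refine ⟨c + c', Submodule.add_mem _ hc hc', g + g', fun x => ?_, ?_⟩
    · rw [map_add, map_add, h1, h1']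
    · filter_upwards [h2, h2', Lp.coeFn_add v w] with ω e1 e2 e3
      rw [e3, Pi.add_apply, e1, e2, map_add]
  | smul z w _ hw =>
    obtain ⟨c, hc, g, h1, h2⟩ := hw
    refine ⟨z • c, Submodule.smul_mem _ _ hc, z • g, fun x => ?_, ?_⟩
    · rw [map_smul, map_smul, h1]
    · filter_upwards [h2, Lp.coeFn_smul z w] with ω e1 e2
      rw [e2, Pi.smul_apply, e1, map_smul]

/-- With the functional written as increments minus `v`, the condition on `c` says that `c + v` is a
combination of increments. As it involves only observed times, it is one of past increments. -/
theorem mem_linearEstimates_increment_iff (hmeas : ∀ k, AEMeasurable (ξ k) P)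
    (hξ : HasStationaryIncrements P n ξ) {μ : ℕ} (hμ : 0 < μ) (N : ℕ) (a : ℕ → ℂ) (η : Ω → ℂ) :
    η ∈ linearEstimates P ξ (incrementErrorCoeffs n N a) ↔
      ∃ w ∈ (pastIncrements hξ).topologicalClosure,
        η =ᵐ[P] fun ω => -observedPart n μ N a ξ ω + w ω := by
  set gB : ℤ × ℤ →₀ ℂ :=
    ∑ k ∈ Finset.range (N + 1), Finsupp.single ((k : ℤ), (μ : ℤ)) (bCoeff n μ N a k)
  have hgB : ∀ x : ℤ → ℂ, Finsupp.linearCombination ℂ (fun p : ℤ × ℤ => nthIncr n x p.1 p.2) gB =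
      ∑ k ∈ Finset.range (N + 1), bCoeff n μ N a k * nthIncr n x k μ := fun x => by
    rw [map_sum]
    simp
  have hid := sum_eq_increments_sub n hμ N a
  have hv := observedPartCoeffs_mem n μ N a
  have hvs := sum_observedPartCoeffs n μ N a
  refine mem_linearEstimates_iff (aemeasurable_observedPart hmeas n μ N a) ?_ ?_ η
  · rintro c ⟨hc, g, hg⟩
    rw [observedCoeffs_eq] at hc
    have hc' : c + observedPartCoeffs n μ N a ∈ observedCoeffs := by
      rw [observedCoeffs_eq]
      exact Submodule.add_mem _ hc hv
    obtain ⟨q, hq, hqs⟩ := exists_combination_past_increments (n := n) hc' (g := gB - g) fun x => by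
      have h1 := hg x
      rw [hid x, ← hvs x, sum_mul_eq_linearCombination, sum_mul_eq_linearCombination,
        sum_nthIncr_eq_linearCombination, ← hgB x] at h1
      rw [sum_mul_eq_linearCombination, sum_nthIncr_eq_linearCombination, map_add, map_sub]
      linear_combination -h1
    refine ⟨∑ k ∈ q.support, q k • (hξ.memLp k 1).toLp _,
      Submodule.sum_mem _ fun k hk => Submodule.smul_mem _ _
        (Submodule.subset_span ⟨(k, 1), ⟨hq k hk, one_pos⟩, rfl⟩), ?_⟩
    have hX := memLp_finsetSum q.support fun k _ => (hξ.memLp k 1).const_mul (q k)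
    have h2 := toLp_sum_mul q.support q (fun k => hξ.memLp k 1) hX
    rw [← h2]
    filter_upwards [hX.coeFn_toLp] with ω hω
    rw [hω]
    have h3 := hqs fun k => ξ k ω
    rw [sum_mul_eq_linearCombination, map_add, ← sum_mul_eq_linearCombination,
      ← sum_mul_eq_linearCombination, hvs] at h3
    change _ = -(∑ k ∈ Finset.Icc (-((μ : ℤ) * n)) (-1), vCoeff n μ N a k * ξ k ω) + _
    rw [← sub_eq_neg_add, eq_sub_iff_add_eq, h3]
    rfl
  · intro w hw
    obtain ⟨c, hc, g, h1, h2⟩ := exists_coeffs_of_mem_pastIncrements hξ hw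
    refine ⟨c - observedPartCoeffs n μ N a, ⟨?_, gB - g, fun x => ?_⟩, ?_⟩
    · rw [observedCoeffs_eq]
      exact Submodule.sub_mem _ hc hv
    · have h3 := h1 x
      rw [sum_mul_eq_linearCombination, sum_nthIncr_eq_linearCombination] at h3
      rw [hid x, ← hvs x, sum_mul_eq_linearCombination, sum_mul_eq_linearCombination,
        sum_nthIncr_eq_linearCombination, ← hgB x, map_sub, map_sub, h3]
      ring
    · filter_upwards [h2] with ω hω
      have h4 := hvs fun k => ξ k ω
      rw [hω, sum_mul_eq_linearCombination, map_sub, ← sum_mul_eq_linearCombination,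
        ← sum_mul_eq_linearCombination, h4]
      exact sub_eq_neg_add _ _

/-- The span of the observed values. -/
def observedSpan (hL2 : ∀ k : ℤ, k ≤ -1 → MemLp (ξ k) 2 P) : Submodule ℂ (Lp ℂ 2 P) :=
  Submodule.span ℂ (Set.range fun k : Set.Iic (-1 : ℤ) => (hL2 k.1 k.2).toLp _)

theorem exists_mem_observedSpan (hL2 : ∀ k : ℤ, k ≤ -1 → MemLp (ξ k) 2 P) {c : ℤ →₀ ℂ}
    (hc : c ∈ Finsupp.supported ℂ ℂ (Set.Iic (-1 : ℤ))) :
    ∃ w ∈ observedSpan hL2, w =ᵐ[P] fun ω => c.sum fun k z => z * ξ k ω := by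
  have hX : MemLp (fun ω => c.sum fun k z => z * ξ k ω) 2 P :=
    memLp_finsetSum _ fun k hk => (hL2 k (hc hk)).const_mul _
  refine ⟨hX.toLp _, ?_, hX.coeFn_toLp⟩
  have h : hX.toLp _ = ∑ k ∈ c.support.attach, c k.1 • (hL2 k.1 (hc k.2)).toLp (ξ k.1) := by
    have hX' : MemLp (fun ω => ∑ k ∈ c.support.attach, c k.1 * ξ k.1 ω) 2 P :=
      memLp_finsetSum _ fun k _ => (hL2 k.1 (hc k.2)).const_mul _
    rw [← toLp_sum_mul c.support.attach (fun k => c k.1) (fun k => hL2 k.1 (hc k.2)) hX']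
    refine MemLp.toLp_congr _ _ (Eventually.of_forall fun ω => ?_)
    exact (Finset.sum_attach c.support fun k => c k * ξ k ω).symm
  rw [h]
  exact Submodule.sum_mem _ fun k _ => Submodule.smul_mem _ _
    (Submodule.subset_span ⟨⟨k.1, hc k.2⟩, rfl⟩)

theorem exists_coeffs_of_mem_observedSpan (hL2 : ∀ k : ℤ, k ≤ -1 → MemLp (ξ k) 2 P)
    {w : Lp ℂ 2 P} (hw : w ∈ observedSpan hL2) :
    ∃ c ∈ Finsupp.supported ℂ ℂ (Set.Iic (-1 : ℤ)),
      w =ᵐ[P] fun ω => c.sum fun k z => z * ξ k ω := by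
  simp only [sum_mul_eq_linearCombination]
  induction hw using Submodule.span_induction with
  | mem w hw =>
    obtain ⟨k, rfl⟩ := hw
    refine ⟨Finsupp.single k.1 1, Finsupp.single_mem_supported _ _ k.2, ?_⟩
    filter_upwards [(hL2 k.1 k.2).coeFn_toLp] with ω hω
    simp [hω]
  | zero =>
    refine ⟨0, Submodule.zero_mem _, ?_⟩
    filter_upwards [Lp.coeFn_zero ℂ 2 P] with ω hω
    rw [hω, map_zero, Pi.zero_apply]
  | add v w _ _ hv hw =>
    obtain ⟨c, hc, h2⟩ := hv
    obtain ⟨c', hc', h2'⟩ := hw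
    refine ⟨c + c', Submodule.add_mem _ hc hc', ?_⟩
    filter_upwards [h2, h2', Lp.coeFn_add v w] with ω e1 e2 e3
    rw [e3, Pi.add_apply, e1, e2, map_add]
  | smul z w _ hw =>
    obtain ⟨c, hc, h2⟩ := hw
    refine ⟨z • c, Submodule.smul_mem _ _ hc, ?_⟩
    filter_upwards [h2, Lp.coeFn_smul z w] with ω e1 e2
    rw [e2, Pi.smul_apply, e1, map_smul]

/-- The translation by the observed part is harmless, as it is itself observed; it gives both
classes of estimates the same form for the projection theorem. -/
theorem mem_linearEstimates_observed_iff (hmeas : ∀ k, AEMeasurable (ξ k) P)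
    (hL2 : ∀ k : ℤ, k ≤ -1 → MemLp (ξ k) 2 P) (n μ N : ℕ) (a : ℕ → ℂ) (η : Ω → ℂ) :
    η ∈ linearEstimates P ξ observedCoeffs ↔
      ∃ w ∈ (observedSpan hL2).topologicalClosure,
        η =ᵐ[P] fun ω => -observedPart n μ N a ξ ω + w ω := by
  have hv := observedPartCoeffs_mem n μ N a
  have hvs := sum_observedPartCoeffs n μ N a
  rw [observedCoeffs_eq]
  refine mem_linearEstimates_iff (aemeasurable_observedPart hmeas n μ N a) ?_ ?_ η
  · intro c hc
    obtain ⟨w, hw, h⟩ := exists_mem_observedSpan hL2 (Submodule.add_mem _ hc hv)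
    refine ⟨w, hw, ?_⟩
    filter_upwards [h] with ω hω
    have h4 := hvs fun k => ξ k ω
    rw [hω, sum_mul_eq_linearCombination, sum_mul_eq_linearCombination, map_add,
      ← sum_mul_eq_linearCombination _ (observedPartCoeffs n μ N a), h4]
    exact (neg_add_eq_of_eq_add (add_comm _ _)).symm
  · intro w hw
    obtain ⟨c, hc, h⟩ := exists_coeffs_of_mem_observedSpan hL2 hw
    refine ⟨c - observedPartCoeffs n μ N a, Submodule.sub_mem _ hc hv, ?_⟩
    filter_upwards [h] with ω hω
    have h4 := hvs fun k => ξ k ω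
    rw [hω, sum_mul_eq_linearCombination, map_sub, ← sum_mul_eq_linearCombination,
      ← sum_mul_eq_linearCombination, h4]
    exact sub_eq_neg_add _ _

theorem pastIncrements_le_observedSpan (hξ : HasStationaryIncrements P n ξ)
    (hL2 : ∀ k : ℤ, k ≤ -1 → MemLp (ξ k) 2 P) : pastIncrements hξ ≤ observedSpan hL2 := by
  intro w hw
  obtain ⟨c, hc, -, -, h⟩ := exists_coeffs_of_mem_pastIncrements hξ hw
  obtain ⟨w', hw', h'⟩ := exists_mem_observedSpan hL2 hc
  rwa [Lp.ext (h.trans h'.symm)]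

end Classes

/-! ### The optimal estimate -/

section OptimalEstimate

open scoped InnerProductSpace

variable {Ω : Type*} [MeasurableSpace Ω] {P : Measure Ω} {n μ : ℕ} {ξ ε : ℤ → Ω → ℂ} {φ : ℕ → ℂ}

/-- `∑_{k ≤ N} b_{μ,N}(k) ξ⁽ⁿ⁾(k, μ)`. -/
def incrementPart (hξ : HasStationaryIncrements P n ξ) (μ N : ℕ) (a : ℕ → ℂ) : Lp ℂ 2 P :=
  ∑ k ∈ Finset.range (N + 1), bCoeff n μ N a k • (hξ.memLp k μ).toLp _

/-- The error `∑_{j ≤ N} (D_N^μ A_N φ_{μ,N})_j ε(j)` of the optimal estimate. -/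
def errorPart (hε : IsInnovation P n ξ ε) (μ N : ℕ) (a φ : ℕ → ℂ) : Lp ℂ 2 P :=
  ∑ j, errorVec n μ N a φ j • (hε.memLp ((j : ℕ) : ℤ)).toLp _

theorem functionalAN_ae_eq (hξ : HasStationaryIncrements P n ξ) (hμ : 0 < μ)
    (hε : IsInnovation P n ξ ε) (N : ℕ) (a : ℕ → ℂ) :
    functionalAN N a ξ =ᵐ[P] fun ω => -observedPart n μ N a ξ ω +
      (incrementPart hξ μ N a - errorPart hε μ N a φ : Lp ℂ 2 P) ω + errorPart hε μ N a φ ω := by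
  have hX := memLp_finsetSum (Finset.range (N + 1)) fun k _ =>
    (hξ.memLp k μ).const_mul (bCoeff n μ N a k)
  have h1 : hX.toLp _ = incrementPart hξ μ N a :=
    toLp_sum_mul (Finset.range (N + 1)) (bCoeff n μ N a) (fun k : ℕ => hξ.memLp k μ) hX
  rw [← h1]
  filter_upwards [hX.coeFn_toLp, Lp.coeFn_sub (hX.toLp _) (errorPart hε μ N a φ)] with ω h2 h3
  rw [h3, Pi.sub_apply, h2]
  have h4 := sum_eq_increments_sub n hμ N a fun k => ξ k ω
  change ∑ k ∈ Finset.range (N + 1), a k * ξ k ω =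
    -(∑ k ∈ Finset.Icc (-((μ : ℤ) * n)) (-1), vCoeff n μ N a k * ξ k ω) +
      (∑ k ∈ Finset.range (N + 1), bCoeff n μ N a k * nthIncr n (fun k => ξ k ω) k μ -
        errorPart hε μ N a φ ω) + errorPart hε μ N a φ ω
  rw [h4]
  ring

theorem norm_errorPart_sq (hε : IsInnovation P n ξ ε) (N : ℕ) (a : ℕ → ℂ) :
    ‖errorPart hε μ N a φ‖ ^ 2 = ∑ j, ‖errorVec n μ N a φ j‖ ^ 2 := by
  have hon : Orthonormal ℂ fun j : Fin (N + 1) => (hε.memLp ((j : ℕ) : ℤ)).toLp _ :=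
    (orthonormal_innovation hε).comp (fun j : Fin (N + 1) => ((j : ℕ) : ℤ))
      fun i j h => Fin.ext (by simpa using h)
  have h := hon.inner_sum (errorVec n μ N a φ) (errorVec n μ N a φ) Finset.univ
  rw [errorPart]
  rw [inner_self_eq_norm_sq_to_K] at h
  have h2 : ∀ z : ℂ, starRingEnd ℂ z * z = ((‖z‖ ^ 2 : ℝ) : ℂ) := fun z => by
    rw [Complex.conj_mul', Complex.ofReal_pow]
  simp only [h2] at h
  exact Complex.ofReal_injective
    ((Complex.ofReal_pow _ _).trans (h.trans (Complex.ofReal_sum _ _).symm))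

theorem topologicalClosure_pastIncrements (hξ : HasStationaryIncrements P n ξ)
    (hε : IsInnovation P n ξ ε) : (pastIncrements hξ).topologicalClosure =
      (Submodule.span ℂ ((fun m => (hε.memLp m).toLp (ε m)) '' Set.Iic (-1))).topologicalClosure := by
  have h := hε.past (-1)
  rw [closedSpan_eq hε.memLp, closedSpan_eq (X := fun p : ℤ × ℤ => incr n ξ p.1 p.2)
    (fun p => hξ.memLp p.1 p.2)] at h
  exact h

/-- The terms removed are exactly those with `ε(j)`, `j ≥ 0`; the remaining partial sums lie in the
span of the `ε(m)`, `m ≤ -1`. -/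
theorem increment_sub_mem_past (hξ : HasStationaryIncrements P n ξ)
    (hMA : IsCanonicalMovingAverage P n μ ξ ε φ) (k : ℕ) :
    (hξ.memLp k μ).toLp _ - ∑ m ∈ Finset.range (k + 1),
      φ m • (hMA.innovation.memLp ((k : ℤ) - m)).toLp _ ∈
        (pastIncrements hξ).topologicalClosure := by
  rw [topologicalClosure_pastIncrements hξ hMA.innovation]
  set W := (Submodule.span ℂ
    ((fun m => (hMA.innovation.memLp m).toLp (ε m)) '' Set.Iic (-1)))
  have hmem : ∀ K : ℕ, MemLp (fun ω => ∑ m ∈ Finset.range K, φ m * ε (k - m) ω) 2 P := fun K =>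
    memLp_finsetSum _ fun m _ => (hMA.innovation.memLp _).const_mul _
  have h1 := (tendsto_toLp_iff hmem (hξ.memLp k μ)).2 (hMA.hasSum k)
  refine W.isClosed_topologicalClosure.mem_of_tendsto (h1.sub_const _) ?_
  filter_upwards [eventually_ge_atTop (k + 1)] with K hK
  rw [toLp_sum_mul _ _ (fun m : ℕ => hMA.innovation.memLp (k - m)),
    ← Finset.sum_range_add_sum_Ico _ hK, add_sub_cancel_left]
  refine Submodule.le_topologicalClosure _ (Submodule.sum_mem _ fun m hm =>
    Submodule.smul_mem _ _ (Submodule.subset_span ⟨k - m, ?_, rfl⟩))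
  rw [Finset.mem_Ico] at hm
  rw [Set.mem_Iic]
  omega

theorem incrementPart_sub_errorPart_mem (hξ : HasStationaryIncrements P n ξ)
    (hMA : IsCanonicalMovingAverage P n μ ξ ε φ) (N : ℕ) (a : ℕ → ℂ) :
    incrementPart hξ μ N a - errorPart hMA.innovation μ N a φ ∈
      (pastIncrements hξ).topologicalClosure := by
  rw [errorPart, sum_errorVec_smul n μ N a φ fun m => (hMA.innovation.memLp m).toLp (ε m),
    incrementPart, ← Finset.sum_sub_distrib]
  simp only [← smul_sub]
  exact Submodule.sum_mem _ fun k _ =>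
    Submodule.smul_mem _ _ (increment_sub_mem_past hξ hMA k)

theorem inner_errorPart_eq_zero (hε : IsInnovation P n ξ ε) (N : ℕ) (a : ℕ → ℂ) {A : Set (Lp ℂ 2 P)}
    (hA : ∀ w ∈ A, ∀ j : ℤ, 0 ≤ j → ⟪w, (hε.memLp j).toLp (ε j)⟫_ℂ = 0) :
    ∀ w ∈ (Submodule.span ℂ A).topologicalClosure, ⟪w, errorPart hε μ N a φ⟫_ℂ = 0 := by
  refine fun w hw => inner_eq_zero_of_mem_topologicalClosure_span (fun z hz => ?_) hw
  rw [errorPart, inner_sum]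
  refine Finset.sum_eq_zero fun j _ => ?_
  rw [inner_smul_right, hA z hz _ (Int.natCast_nonneg _), mul_zero]

theorem isOptimalEstimate_increment_iff (hmeas : ∀ k, AEMeasurable (ξ k) P) (hμ : 0 < μ)
    (hξ : HasStationaryIncrements P n ξ) (hMA : IsCanonicalMovingAverage P n μ ξ ε φ) (N : ℕ)
    (a : ℕ → ℂ) (η : Ω → ℂ) :
    IsOptimalEstimate P ξ (incrementErrorCoeffs n N a) (functionalAN N a ξ) η ↔
      η =ᵐ[P] fun ω => -observedPart n μ N a ξ ω +
        (incrementPart hξ μ N a - errorPart hMA.innovation μ N a φ : Lp ℂ 2 P) ω := by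
  refine isOptimalEstimate_iff (mem_linearEstimates_increment_iff hmeas hξ hμ N a)
    (incrementPart_sub_errorPart_mem hξ hMA N a) ?_
    (functionalAN_ae_eq hξ hμ hMA.innovation N a) η
  rw [topologicalClosure_pastIncrements hξ hMA.innovation]
  refine inner_errorPart_eq_zero hMA.innovation N a ?_
  rintro _ ⟨m, hm, rfl⟩ j hj
  refine (orthonormal_innovation hMA.innovation).2 ?_
  rw [Set.mem_Iic] at hm
  omega

/-- The decomposition is that of the smaller class: the projection stays in the larger closed span,
and the assumed uncorrelatedness makes the error orthogonal to it. -/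
theorem isOptimalEstimate_observed_iff (hmeas : ∀ k, AEMeasurable (ξ k) P) (hμ : 0 < μ)
    (hξ : HasStationaryIncrements P n ξ) (hMA : IsCanonicalMovingAverage P n μ ξ ε φ)
    (hL2 : ∀ k : ℤ, k ≤ -1 → MemLp (ξ k) 2 P)
    (huncorr : ∀ k j : ℤ, k ≤ -1 → 0 ≤ j → ∫ ω, ξ k ω * starRingEnd ℂ (ε j ω) ∂P = 0) (N : ℕ)
    (a : ℕ → ℂ) (η : Ω → ℂ) :
    IsOptimalEstimate P ξ observedCoeffs (functionalAN N a ξ) η ↔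
      η =ᵐ[P] fun ω => -observedPart n μ N a ξ ω +
        (incrementPart hξ μ N a - errorPart hMA.innovation μ N a φ : Lp ℂ 2 P) ω := by
  refine isOptimalEstimate_iff (mem_linearEstimates_observed_iff hmeas hL2 n μ N a)
    (Submodule.topologicalClosure_mono (pastIncrements_le_observedSpan hξ hL2)
      (incrementPart_sub_errorPart_mem hξ hMA N a)) ?_
    (functionalAN_ae_eq hξ hμ hMA.innovation N a) η
  refine inner_errorPart_eq_zero hMA.innovation N a ?_
  rintro _ ⟨k, rfl⟩ j hj
  rw [← inner_conj_symm, inner_toLp_toLp, huncorr k.1 j k.2 hj, map_zero]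

end OptimalEstimate

/-! ### The spectral characteristic -/

section SpectralCharacteristic

variable {Ω : Type*} [MeasurableSpace Ω] {P : Measure Ω} {n μ : ℕ} {ξ ε : ℤ → Ω → ℂ} {φ : ℕ → ℂ}
  {f : ℝ → ℝ} [IsFiniteMeasure (spectralMeasure f)]
  {J : Lp ℂ 2 (spectralMeasure f) →ₗᵢ[ℂ] Lp ℂ 2 P}

theorem symbolA_eq (n μ N : ℕ) (a : ℕ → ℂ) (t : ℝ) :
    symbolA n μ N a t =
      ∑ k ∈ Finset.range (N + 1), bCoeff n μ N a k * Complex.exp (Complex.I * t * k) := by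
  rw [symbolA, trigPoly]
  simp only [mulVec_matD]
  rw [Fin.sum_univ_eq_sum_range
    (fun k => bCoeff n μ N a k * Complex.exp (Complex.I * t * k)) (N + 1)]

/-- The optimal estimate, without its observed part, is the stochastic integral of the spectral
characteristic. -/
theorem exists_isometry_specChar_eq (hξ : HasStationaryIncrements P n ξ)
    (hJ : ∀ m s, J (kernelLp (spectralMeasure f) n m s) = (hξ.memLp m s).toLp _)
    (hε : IsInnovation P n ξ ε) {g : Lp ℂ 2 (spectralMeasure f)}
    (hg : ∀ j, J (shiftLp (spectralMeasure f) j g) = (hε.memLp j).toLp (ε j))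
    (hgt : ∀ᵐ t ∂(spectralMeasure f), g t = transfer n μ t * (boundary φ t)⁻¹) (N : ℕ)
    (a : ℕ → ℂ) :
    ∃ h : MemLp (fun t => specChar n μ N a φ t * transfer n μ t) 2 (spectralMeasure f),
      J (h.toLp _) = incrementPart hξ μ N a - errorPart hε μ N a φ := by
  have hX := memLp_finsetSum (Finset.range (N + 1)) fun k _ =>
    (memLp_kernel (spectralMeasure f) n k μ).const_mul (bCoeff n μ N a k)
  have hX1 := toLp_sum_mul (Finset.range (N + 1)) (bCoeff n μ N a)
    (fun k : ℕ => memLp_kernel (spectralMeasure f) n k μ) hX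
  have hY := memLp_finsetSum (Finset.univ : Finset (Fin (N + 1))) fun j _ =>
    (memLp_exp_mul ((j : ℕ) : ℤ) (Lp.memLp g)).const_mul (errorVec n μ N a φ j)
  have hY1 := toLp_sum_mul (Finset.univ : Finset (Fin (N + 1))) (errorVec n μ N a φ)
    (fun j => memLp_exp_mul ((j : ℕ) : ℤ) (Lp.memLp g)) hY
  have hae : (fun t => (∑ k ∈ Finset.range (N + 1), bCoeff n μ N a k *
      (Complex.exp (Complex.I * t * (k : ℤ)) * transfer n μ t)) -
        ∑ j : Fin (N + 1), errorVec n μ N a φ j *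
          (Complex.exp (Complex.I * t * ((j : ℕ) : ℤ)) * g t)) =ᵐ[spectralMeasure f]
      fun t => specChar n μ N a φ t * transfer n μ t := by
    filter_upwards [hgt] with t ht
    rw [specChar, symbolA_eq, symbolR, trigPoly, ht, sub_mul, Finset.sum_mul, Finset.sum_mul,
      Finset.sum_mul]
    simp only [Int.cast_natCast]
    congr 1
    · exact Finset.sum_congr rfl fun k _ => by ring
    · exact Finset.sum_congr rfl fun k _ => by ring
  have hmem := (hX.sub hY).ae_eq hae
  refine ⟨hmem, ?_⟩
  have h1 : hmem.toLp _ = hX.toLp _ - hY.toLp _ := by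
    rw [← MemLp.toLp_sub]
    exact MemLp.toLp_congr _ _ hae.symm
  rw [h1, hX1, hY1, map_sub, map_sum, map_sum, incrementPart, errorPart]
  simp only [map_smul, ← shiftLp_eq, hg]
  congr 1
  exact Finset.sum_congr rfl fun k _ => congrArg _ (hJ k μ)

end SpectralCharacteristic

/-- Since `f` is almost nowhere zero, `F`-null sets are Lebesgue-null in `[-π, π)`, and the transfer
function cancels. -/
theorem specChar_unique {Ω : Type*} [MeasurableSpace Ω] {P : Measure Ω} {n μ : ℕ} {ξ : ℤ → Ω → ℂ}
    {f : ℝ → ℝ} {h h' : ℝ → ℂ} (hf : IsSpectralDensity P n ξ f) (hμ : 0 < μ)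
    (hf0 : ∀ᵐ t ∂circleVolume, f t ≠ 0)
    (heq : (fun t => h t * transfer n μ t) =ᵐ[spectralMeasure f]
      fun t => h' t * transfer n μ t) : h =ᵐ[circleVolume] h' := by
  have h1 := (ae_spectralMeasure_iff hf.nonneg hf.integrable).1 heq
  filter_upwards [h1, hf0, transfer_ne_zero_ae n (s := μ) (by exact_mod_cast hμ.ne')]
    with t h2 h3 h4
  exact mul_right_cancel₀ h4 (h2 h3)

end

end StationaryIncrements

/-! ### The theorem -/

theorem theorem3p3 {Ω : Type*} [MeasurableSpace Ω] (P : Measure Ω) [IsProbabilityMeasure P]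
    (n μ N : ℕ) (hμ : 0 < μ)
    (ξ : ℤ → Ω → ℂ) (hmeas : ∀ k, AEMeasurable (ξ k) P) (hξ : HasStationaryIncrements P n ξ)
    (f : ℝ → ℝ) (hf : IsSpectralDensity P n ξ f) (hfac : HasCanonicalFactorization f)
    (ε : ℤ → Ω → ℂ) (φ : ℕ → ℂ) (hMA : IsCanonicalMovingAverage P n μ ξ ε φ)
    (a : ℕ → ℂ) :
    -- the spectral representation of the increments and the optimal estimate exist
    (∃ Z : Set ℝ → Lp ℂ 2 P, IsSpectralRepresentation n ξ (spectralMeasure f) Z) ∧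
    (∃ η, IsOptimalEstimate P ξ (incrementErrorCoeffs n N a) (functionalAN N a ξ) η) ∧
    -- formula for the optimal estimate, with its (unique) spectral characteristic
    (∀ Z : Set ℝ → Lp ℂ 2 P, IsSpectralRepresentation n ξ (spectralMeasure f) Z →
      ∀ η, IsOptimalEstimate P ξ (incrementErrorCoeffs n N a) (functionalAN N a ξ) η →
        IsSpectralCharacteristic n μ N a ξ (spectralMeasure f) Z (specChar n μ N a φ) η ∧
        ∀ h : ℝ → ℂ, IsSpectralCharacteristic n μ N a ξ (spectralMeasure f) Z h η →
          h =ᵐ[circleVolume] specChar n μ N a φ) ∧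
    -- the mean square error
    (∀ η, IsOptimalEstimate P ξ (incrementErrorCoeffs n N a) (functionalAN N a ξ) η →
      mse P (functionalAN N a ξ) η =
        ENNReal.ofReal (1 / (2 * Real.pi) *
          ∫ t in (-Real.pi)..Real.pi, ‖symbolR n μ N a φ t‖ ^ 2)) ∧
    1 / (2 * Real.pi) * ∫ t in (-Real.pi)..Real.pi, ‖symbolR n μ N a φ t‖ ^ 2 =
      ‖WithLp.toLp 2 (errorVec n μ N a φ)‖ ^ 2 ∧
    -- if the observed values are square integrable and uncorrelated with the later innovations,
    -- the same estimate is optimal among all linear estimates from the observed values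
    ((∀ k : ℤ, k ≤ -1 → MemLp (ξ k) 2 P) →
      (∀ k j : ℤ, k ≤ -1 → 0 ≤ j → ∫ ω, ξ k ω * starRingEnd ℂ (ε j ω) ∂P = 0) →
      ∀ η, IsOptimalEstimate P ξ observedCoeffs (functionalAN N a ξ) η ↔
        IsOptimalEstimate P ξ (incrementErrorCoeffs n N a) (functionalAN N a ξ) η) := by
  have : IsFiniteMeasure (spectralMeasure f) := isFiniteMeasure_spectralMeasure hf.integrable
  obtain ⟨J, hJ⟩ := exists_spectralIsometry hξ hf
  obtain ⟨g, hg, hf0, hgt⟩ := exists_innovation_kernel hμ hξ hf hJ hMA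
  have hopt := isOptimalEstimate_increment_iff hmeas hμ hξ hMA N a
  obtain ⟨hmem, hJspec⟩ := exists_isometry_specChar_eq hξ hJ hMA.innovation hg hgt N a
  have hint := integral_norm_sq_trigPoly (errorVec n μ N a φ)
  refine ⟨exists_spectralRepresentation hξ hJ,
    ⟨_, (hopt _).2 (Eventually.of_forall fun _ => rfl)⟩, fun Z hZ η hη => ?_, fun η hη => ?_, ?_,
    fun hL2 huncorr η => ?_⟩
  · have hZJ := isometry_indL2_of_representation hξ hf hJ hZ
    have hη' := (hopt η).1 hη
    refine ⟨⟨_, (hasStochIntegral_iff hZJ _ _).2 ⟨hmem, Lp.memLp _, hJspec.trans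
      (Lp.toLp_coeFn _ _).symm⟩, hη'⟩, ?_⟩
    rintro h ⟨X, hX, hηX⟩
    obtain ⟨hh, hX2, hJX⟩ := (hasStochIntegral_iff hZJ _ _).1 hX
    refine specChar_unique hf hμ hf0 ?_
    -- The estimate fixes the stochastic integral, and injectivity of `J` then fixes the integrand.
    have h1 : X =ᵐ[P] (incrementPart hξ μ N a - errorPart hMA.innovation μ N a φ : Lp ℂ 2 P) := by
      filter_upwards [hη', hηX] with ω h2 h3
      exact add_left_cancel (h3.symm.trans h2)
    have h2 : hX2.toLp X = incrementPart hξ μ N a - errorPart hMA.innovation μ N a φ :=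
      Lp.ext (hX2.coeFn_toLp.trans h1)
    rw [h2, ← hJspec] at hJX
    exact (MemLp.toLp_eq_toLp_iff hh hmem).1 (J.injective hJX)
  · rw [mse_eq_of_ae_eq (functionalAN_ae_eq hξ hμ hMA.innovation N a) ((hopt η).1 hη),
      norm_errorPart_sq, ← hint]
    rfl
  · rw [EuclideanSpace.norm_sq_eq]
    exact hint
  · rw [hopt, isOptimalEstimate_observed_iff hmeas hμ hξ hMA hL2 huncorr N a]
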